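/- Let $\pi : E \to B$ be a smooth fiber bundle (all manifolds finite-dimensional, smooth, Hausdorff and paracompact), and let $\mathrm{Vert} = \ker T\pi \subset TE$. Let $(\mathcal V, \Gamma, \overline{\mathbb F})$ be geometric data on it: a smooth vertical bivector field $\mathcal V$, with associated map $\mathcal V^\sharp : T^*E \to TE$; an Ehresmann connection $\Gamma$, i.e. a smooth bundle projection $\Gamma : TE \to \mathrm{Vert}$ with $\Gamma^2=\Gamma$, with horizontal bundle $\mathrm{Hor}_\Gamma = \ker \Gamma$ and horizontal lift $X \mapsto \mathrm{hor}_\Gamma(X)$ of vector fields on $B$; and a smooth horizontal 2-form $\overline{\mathbb F}$ on $E$ (that is, $i_v \overline{\mathbb F} = 0$ for vertical $v$). Put $$L = \{ (X, i_X \overline{\mathbb F}) + (\mathcal V^\sharp \alpha, \alpha) \mid X \in \mathrm{Hor}_\Gamma,\ \alpha \in \mathrm{Ann}(\mathrm{Hor}_\Gamma) \} \subset TE \oplus T^*E .$$ Then the space of smooth sections of $L$ is closed under the Courant bracket $$[(X_1,\xi_1),(X_2,\xi_2)] = ([X_1,X_2],\ \mathcal L_{X_1}\xi_2 - i_{X_2}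 d\xi_1)$$ if and only if the data are integrable, i.e. the following four conditions hold: 1. $[\mathcal V, \mathcal V] = 0$ (Schouten bracket); 2. $\mathcal L_{\mathrm{hor}_\Gamma(X)} \mathcal V = 0$ for all $X \in \mathfrak X(B)$; 3. $\mathrm{Curv}_\Gamma(X,Y) = \mathcal V^\sharp\big(d(\overline{\mathbb F}(\mathrm{hor}_\Gamma(X), \mathrm{hor}_\Gamma(Y)))\big)$ for all $X, Y \in \mathfrak X(B)$, where $\mathrm{Curv}_\Gamma(X,Y) = [\mathrm{hor}_\Gamma(X), \mathrm{hor}_\Gamma(Y)] - \mathrm{hor}_\Gamma([X,Y])$; 4. $\overline{\mathbb F}$ is horizontally closed: $d\overline{\mathbb F}(u,v,w) = 0$ for all horizontal $u,v,w$. -/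

import Mathlib

open scoped Manifold ContDiff Topology

noncomputable section

namespace CouplingDirac

/-! ### Tensor calculus on a smooth manifold modelled on the normed space `H`

All local formulas below are evaluated at a point `x` in the chart centred at `x`, as Mathlib does
for the Lie bracket `VectorField.mlieBracket` of vector fields. -/

section Calculus

/-- The cotangent space `T*ₓM`. -/
abbrev Cotangent (H : Type*) [NormedAddCommGroup H] [NormedSpace ℝ H]
    {M : Type*} [TopologicalSpace M] [ChartedSpace H M] (x : M) : Type _ :=
  TangentSpace 𝓘(ℝ, H) x →L[ℝ] ℝ

variable {H : Type*} [NormedAddCommGroup H] [NormedSpace ℝ H]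
  {M : Type*} [TopologicalSpace M] [ChartedSpace H M]

/-- `X` is a smooth vector field, i.e. a smooth section of `TM`. -/
def IsSmoothVectorField [IsManifold 𝓘(ℝ, H) ∞ M]
    (X : (x : M) → TangentSpace 𝓘(ℝ, H) x) : Prop :=
  ContMDiff 𝓘(ℝ, H) (𝓘(ℝ, H).prod 𝓘(ℝ, H)) ∞
    (fun x ↦ Bundle.TotalSpace.mk' H x (X x))

/-- `ξ` is a smooth 1-form, i.e. a smooth section of `T*M`. -/
def IsSmoothOneForm [IsManifold 𝓘(ℝ, H) ∞ M] (ξ : (x : M) → Cotangent H x) : Prop :=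
  ContMDiff 𝓘(ℝ, H) (𝓘(ℝ, H).prod 𝓘(ℝ, H →L[ℝ] ℝ)) ∞
    (fun x ↦ Bundle.TotalSpace.mk' (H →L[ℝ] ℝ) (E := fun x : M ↦ Cotangent H x) x (ξ x))

/-- A smooth 2-form `σ`, as a smooth section of `Hom(TM, T*M)` with alternating values;
`σ v w` is `σ(v, w)`, so that the contraction `i_v σ = σ(v, ·)` is `σ v`. -/
structure TwoForm (H : Type*) [NormedAddCommGroup H] [NormedSpace ℝ H]
    (M : Type*) [TopologicalSpace M] [ChartedSpace H M] [IsManifold 𝓘(ℝ, H) ∞ M] where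
  toFun : (x : M) → TangentSpace 𝓘(ℝ, H) x →L[ℝ] Cotangent H x
  alternating : ∀ (x : M) (v : TangentSpace 𝓘(ℝ, H) x), toFun x v v = 0
  smooth : ContMDiff 𝓘(ℝ, H) (𝓘(ℝ, H).prod 𝓘(ℝ, H →L[ℝ] H →L[ℝ] ℝ)) ∞
    (fun x ↦ Bundle.TotalSpace.mk' (H →L[ℝ] H →L[ℝ] ℝ)
      (E := fun x : M ↦ TangentSpace 𝓘(ℝ, H) x →L[ℝ] Cotangent H x) x (toFun x))

/-- A smooth bivector field `V` on a finite-dimensional manifold, given by the smooth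
skew-symmetric bundle map `V^♯ : T*M → TM`, where `β (V^♯ α) = V(α, β)`. -/
structure BivectorField (H : Type*) [NormedAddCommGroup H] [NormedSpace ℝ H]
    (M : Type*) [TopologicalSpace M] [ChartedSpace H M] [IsManifold 𝓘(ℝ, H) ∞ M] where
  sharp : (x : M) → Cotangent H x →L[ℝ] TangentSpace 𝓘(ℝ, H) x
  alternating : ∀ (x : M) (α : Cotangent H x), α (sharp x α) = 0
  smooth : ContMDiff 𝓘(ℝ, H) (𝓘(ℝ, H).prod 𝓘(ℝ, (H →L[ℝ] ℝ) →L[ℝ] H)) ∞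
    (fun x ↦ Bundle.TotalSpace.mk' ((H →L[ℝ] ℝ) →L[ℝ] H)
      (E := fun x : M ↦ Cotangent H x →L[ℝ] TangentSpace 𝓘(ℝ, H) x) x (sharp x))

/-- The value `V(α, β)` of a bivector field on two covectors. -/
def BivectorField.eval [IsManifold 𝓘(ℝ, H) ∞ M] (V : BivectorField H M) (x : M)
    (α β : Cotangent H x) : ℝ :=
  β (V.sharp x α)

/-- The differential `df` of a real function, as a 1-form. -/
def differential (f : M → ℝ) (x : M) : Cotangent H x := mvfderiv 𝓘(ℝ, H) f x

/-- The derivative at `x` of the chart centred at `x₀`. -/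
def chartDeriv (x₀ x : M) : TangentSpace 𝓘(ℝ, H) x →L[ℝ] H :=
  mfderiv 𝓘(ℝ, H) 𝓘(ℝ, H) (extChartAt 𝓘(ℝ, H) x₀) x

/-- The inverse `H → TₓM` of the derivative at `x` of the chart centred at `x₀`. -/
def chartDerivInv (x₀ x : M) : H →L[ℝ] TangentSpace 𝓘(ℝ, H) x := (chartDeriv x₀ x).inverse

/-- A 1-form read in the chart centred at `x₀`. -/
def oneFormInChart (ξ : (x : M) → Cotangent H x) (x₀ : M) (y : H) : H →L[ℝ] ℝ :=
  let x := (extChartAt 𝓘(ℝ, H) x₀).symm y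
  (ξ x).comp (chartDerivInv x₀ x)

/-- A 2-form read in the chart centred at `x₀`. -/
def TwoForm.inChart [IsManifold 𝓘(ℝ, H) ∞ M] (σ : TwoForm H M) (x₀ : M) (y : H) :
    H →L[ℝ] H →L[ℝ] ℝ :=
  let x := (extChartAt 𝓘(ℝ, H) x₀).symm y
  ((ContinuousLinearMap.precomp ℝ (chartDerivInv x₀ x)).comp (σ.toFun x)).comp (chartDerivInv x₀ x)

/-- A bivector field (more precisely, its map `V^♯`) read in the chart centred at `x₀`. -/
def BivectorField.inChart [IsManifold 𝓘(ℝ, H) ∞ M] (V : BivectorField H M) (x₀ : M) (y : H) :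
    (H →L[ℝ] ℝ) →L[ℝ] H :=
  let x := (extChartAt 𝓘(ℝ, H) x₀).symm y
  ((chartDeriv x₀ x).comp (V.sharp x)).comp (ContinuousLinearMap.precomp ℝ (chartDeriv x₀ x))

/-- The exterior derivative of a 1-form:
`dξ(u, v) = (D_u ξ)(v) - (D_v ξ)(u)` in the chart centred at the point. -/
def extDerivOne (ξ : (x : M) → Cotangent H x) (x : M) :
    TangentSpace 𝓘(ℝ, H) x →L[ℝ] Cotangent H x :=
  let D : H →L[ℝ] H →L[ℝ] ℝ := fderiv ℝ (oneFormInChart ξ x) (extChartAt 𝓘(ℝ, H) x x)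
  ((ContinuousLinearMap.precomp ℝ (chartDeriv x x)).comp (D - D.flip)).comp (chartDeriv x x)

/-- The exterior derivative of a 2-form:
`dσ(u, v, w) = (D_u σ)(v, w) - (D_v σ)(u, w) + (D_w σ)(u, v)` in the chart centred at the point. -/
def TwoForm.extDeriv [IsManifold 𝓘(ℝ, H) ∞ M] (σ : TwoForm H M) (x : M)
    (u v w : TangentSpace 𝓘(ℝ, H) x) : ℝ :=
  let D : H →L[ℝ] H →L[ℝ] H →L[ℝ] ℝ := fderiv ℝ (σ.inChart x) (extChartAt 𝓘(ℝ, H) x x)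
  let u' := chartDeriv x x u
  let v' := chartDeriv x x v
  let w' := chartDeriv x x w
  D u' v' w' - D v' u' w' + D w' u' v'

/-- The Lie derivative of a 1-form along a vector field, `L_X ξ = i_X dξ + d(i_X ξ)`. -/
def lieDerivOneForm (X : (x : M) → TangentSpace 𝓘(ℝ, H) x) (ξ : (x : M) → Cotangent H x)
    (x : M) : Cotangent H x :=
  extDerivOne ξ x (X x) + differential (fun y ↦ ξ y (X y)) x

/-- The Lie derivative of a bivector field along a vector field, evaluated on two 1-forms:
`(L_X V)(α, β) = X(V(α, β)) - V(L_X α, β) - V(α, L_X β)`. -/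
def BivectorField.lieDeriv [IsManifold 𝓘(ℝ, H) ∞ M]
    (X : (x : M) → TangentSpace 𝓘(ℝ, H) x) (V : BivectorField H M)
    (α β : (x : M) → Cotangent H x) (x : M) : ℝ :=
  differential (fun y ↦ V.eval y (α y) (β y)) x (X x)
    - V.eval x (lieDerivOneForm X α x) (β x) - V.eval x (α x) (lieDerivOneForm X β x)

/-- The Schouten bracket of two bivector fields, as a trivector field evaluated on three covectors.
In the coordinates of the chart centred at the point it has the components
`[P, Q]^{ijk} = ∑_{cyclic (i,j,k)} ∑_l (P^{il} ∂_l Q^{jk} + Q^{il} ∂_l P^{jk})`. -/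
def schoutenBracket [IsManifold 𝓘(ℝ, H) ∞ M] (P Q : BivectorField H M) (x : M)
    (α β γ : Cotangent H x) : ℝ :=
  let y : H := extChartAt 𝓘(ℝ, H) x x
  let P' : H → (H →L[ℝ] ℝ) →L[ℝ] H := P.inChart x
  let Q' : H → (H →L[ℝ] ℝ) →L[ℝ] H := Q.inChart x
  let T : (H →L[ℝ] ℝ) → (H →L[ℝ] ℝ) → (H →L[ℝ] ℝ) → ℝ := fun a b c ↦
    c (fderiv ℝ Q' y (P' y a) b) + c (fderiv ℝ P' y (Q' y a) b)
  let a : H →L[ℝ] ℝ := α.comp (chartDerivInv x x)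
  let b : H →L[ℝ] ℝ := β.comp (chartDerivInv x x)
  let c : H →L[ℝ] ℝ := γ.comp (chartDerivInv x x)
  T a b c + T b c a + T c a b

/-- The Courant bracket on sections of `TM ⊕ T*M`,
`[(X, ξ), (Y, η)] = ([X, Y], L_X η - i_Y dξ)`. -/
def courantBracket (X : (x : M) → TangentSpace 𝓘(ℝ, H) x) (ξ : (x : M) → Cotangent H x)
    (Y : (x : M) → TangentSpace 𝓘(ℝ, H) x) (η : (x : M) → Cotangent H x) (x : M) :
    TangentSpace 𝓘(ℝ, H) x × Cotangent H x :=
  (VectorField.mlieBracket 𝓘(ℝ, H) X Y x, lieDerivOneForm X η x - extDerivOne ξ x (Y x))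

/-- The space of smooth sections of the family `L` of subspaces of the fibres of `TM ⊕ T*M` is
closed under the Courant bracket. -/
def IsCourantClosed [IsManifold 𝓘(ℝ, H) ∞ M]
    (L : (x : M) → Submodule ℝ (TangentSpace 𝓘(ℝ, H) x × Cotangent H x)) : Prop :=
  ∀ (X : (x : M) → TangentSpace 𝓘(ℝ, H) x) (ξ : (x : M) → Cotangent H x)
    (Y : (x : M) → TangentSpace 𝓘(ℝ, H) x) (η : (x : M) → Cotangent H x),
    IsSmoothVectorField X → IsSmoothOneForm ξ → (∀ x, (X x, ξ x) ∈ L x) →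
    IsSmoothVectorField Y → IsSmoothOneForm η → (∀ x, (Y x, η x) ∈ L x) →
    ∀ x, courantBracket X ξ Y η x ∈ L x

end Calculus

/-! ### Fibre bundles, Ehresmann connections and geometric data -/

section Bundles

variable {HE : Type*} [NormedAddCommGroup HE] [NormedSpace ℝ HE]
  {HB : Type*} [NormedAddCommGroup HB] [NormedSpace ℝ HB]
  {E : Type*} [TopologicalSpace E] [ChartedSpace HE E]
  {B : Type*} [TopologicalSpace B] [ChartedSpace HB B]

/-- `π : E → B` is a smooth fibre bundle with typical fibre `F`: it is smooth, and every point of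
`B` has an open neighbourhood `U` with a diffeomorphism `π⁻¹(U) ≃ U × F` over `U`. -/
def IsSmoothFiberBundle (HE HB HF : Type*) [NormedAddCommGroup HE] [NormedSpace ℝ HE]
    [NormedAddCommGroup HB] [NormedSpace ℝ HB] [NormedAddCommGroup HF] [NormedSpace ℝ HF]
    {E : Type*} [TopologicalSpace E] [ChartedSpace HE E]
    {B : Type*} [TopologicalSpace B] [ChartedSpace HB B]
    (F : Type*) [TopologicalSpace F] [ChartedSpace HF F] (π : E → B) : Prop :=
  ContMDiff 𝓘(ℝ, HE) 𝓘(ℝ, HB) ∞ π ∧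
  ∀ b : B, ∃ e : Bundle.Trivialization F π, b ∈ e.baseSet ∧
    ContMDiffOn 𝓘(ℝ, HE) (𝓘(ℝ, HB).prod 𝓘(ℝ, HF)) ∞ e e.source ∧
    ContMDiffOn (𝓘(ℝ, HB).prod 𝓘(ℝ, HF)) 𝓘(ℝ, HE) ∞ e.toOpenPartialHomeomorph.symm e.target

/-- The derivative `T_x π : T_x E → T_{π(x)} B`. -/
def tangentMap (HE HB : Type*) [NormedAddCommGroup HE] [NormedSpace ℝ HE]
    [NormedAddCommGroup HB] [NormedSpace ℝ HB]
    {E : Type*} [TopologicalSpace E] [ChartedSpace HE E]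
    {B : Type*} [TopologicalSpace B] [ChartedSpace HB B] (π : E → B) (x : E) :
    TangentSpace 𝓘(ℝ, HE) x →L[ℝ] TangentSpace 𝓘(ℝ, HB) (π x) :=
  mfderiv 𝓘(ℝ, HE) 𝓘(ℝ, HB) π x

/-- The vertical subspace `Vert_x = ker T_x π`. -/
def vert (HE HB : Type*) [NormedAddCommGroup HE] [NormedSpace ℝ HE]
    [NormedAddCommGroup HB] [NormedSpace ℝ HB]
    {E : Type*} [TopologicalSpace E] [ChartedSpace HE E]
    {B : Type*} [TopologicalSpace B] [ChartedSpace HB B] (π : E → B) (x : E) :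
    Submodule ℝ (TangentSpace 𝓘(ℝ, HE) x) :=
  LinearMap.ker (tangentMap HE HB π x).toLinearMap

/-- An Ehresmann connection on `π : E → B`: a smooth bundle map `Γ : TE → TE` which is a
projection (`Γ² = Γ`) of `TE` onto the vertical bundle. -/
structure EhresmannConnection (HE HB : Type*) [NormedAddCommGroup HE] [NormedSpace ℝ HE]
    [NormedAddCommGroup HB] [NormedSpace ℝ HB]
    {E : Type*} [TopologicalSpace E] [ChartedSpace HE E] [IsManifold 𝓘(ℝ, HE) ∞ E]
    {B : Type*} [TopologicalSpace B] [ChartedSpace HB B] (π : E → B) where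
  toFun : (x : E) → TangentSpace 𝓘(ℝ, HE) x →L[ℝ] TangentSpace 𝓘(ℝ, HE) x
  idem : ∀ (x : E) (v : TangentSpace 𝓘(ℝ, HE) x), toFun x (toFun x v) = toFun x v
  range_eq : ∀ x : E, LinearMap.range (toFun x).toLinearMap = vert HE HB π x
  smooth : ContMDiff 𝓘(ℝ, HE) (𝓘(ℝ, HE).prod 𝓘(ℝ, HE →L[ℝ] HE)) ∞
    (fun x ↦ Bundle.TotalSpace.mk' (HE →L[ℝ] HE)
      (E := fun x : E ↦ TangentSpace 𝓘(ℝ, HE) x →L[ℝ] TangentSpace 𝓘(ℝ, HE) x) x (toFun x))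

namespace EhresmannConnection

variable [IsManifold 𝓘(ℝ, HE) ∞ E] {π : E → B} (Γ : EhresmannConnection HE HB π)

/-- The horizontal subspace `Hor_x = ker Γ_x`. -/
def hor (x : E) : Submodule ℝ (TangentSpace 𝓘(ℝ, HE) x) :=
  LinearMap.ker (Γ.toFun x).toLinearMap

/-- The horizontal lift of a vector field `X` on `B`: its value at `x` is the horizontal part
`w - Γ w` of any tangent vector `w` with `T_x π (w) = X(π(x))` (the choice of `w` does not
matter, since two choices differ by a vertical vector). -/
def horLift (X : (b : B) → TangentSpace 𝓘(ℝ, HB) b) (x : E) : TangentSpace 𝓘(ℝ, HE) x :=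
  let w := Function.invFun (tangentMap HE HB π x) (X (π x))
  w - Γ.toFun x w

/-- The curvature of `Γ`, a 2-form on `B` with values in vertical vector fields:
`Curv(X, Y) = [hor X, hor Y] - hor [X, Y]`. -/
def curvature (X Y : (b : B) → TangentSpace 𝓘(ℝ, HB) b) (x : E) : TangentSpace 𝓘(ℝ, HE) x :=
  VectorField.mlieBracket 𝓘(ℝ, HE) (Γ.horLift X) (Γ.horLift Y) x
    - Γ.horLift (VectorField.mlieBracket 𝓘(ℝ, HB) X Y) x

end EhresmannConnection

/-- Geometric data on `π : E → B`: a vertical bivector field `V`, an Ehresmann connection `Γ`, and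
a horizontal 2-form `Fbar` on `E`. -/
structure GeometricData (HE HB : Type*) [NormedAddCommGroup HE] [NormedSpace ℝ HE]
    [NormedAddCommGroup HB] [NormedSpace ℝ HB]
    {E : Type*} [TopologicalSpace E] [ChartedSpace HE E] [IsManifold 𝓘(ℝ, HE) ∞ E]
    {B : Type*} [TopologicalSpace B] [ChartedSpace HB B] (π : E → B) where
  V : BivectorField HE E
  vertical : ∀ (x : E) (α : Cotangent HE x), V.sharp x α ∈ vert HE HB π x
  Γ : EhresmannConnection HE HB π
  Fbar : TwoForm HE E
  horizontal : ∀ (x : E), ∀ v ∈ vert HE HB π x, Fbar.toFun x v = 0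

namespace GeometricData

variable [IsManifold 𝓘(ℝ, HE) ∞ E] {π : E → B}

/-- Integrability of geometric data. -/
structure IsIntegrable [IsManifold 𝓘(ℝ, HB) ∞ B] (D : GeometricData HE HB π) : Prop where
  /-- `V` is a Poisson tensor: `[V, V] = 0`. -/
  poisson : ∀ (x : E) (α β γ : Cotangent HE x), schoutenBracket D.V D.V x α β γ = 0
  /-- `L_{hor X} V = 0` for all vector fields `X` on `B`. -/
  preserves : ∀ X : (b : B) → TangentSpace 𝓘(ℝ, HB) b, IsSmoothVectorField X →
    ∀ α β : (x : E) → Cotangent HE x, IsSmoothOneForm α → IsSmoothOneForm β →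
    ∀ x, D.V.lieDeriv (D.Γ.horLift X) α β x = 0
  /-- `Curv(X, Y) = V^♯ (d (Fbar (hor X, hor Y)))` for all vector fields `X`, `Y` on `B`. -/
  curvature_eq : ∀ X Y : (b : B) → TangentSpace 𝓘(ℝ, HB) b,
    IsSmoothVectorField X → IsSmoothVectorField Y → ∀ x,
    D.Γ.curvature X Y x = D.V.sharp x
      (differential (fun y ↦ D.Fbar.toFun y (D.Γ.horLift X y) (D.Γ.horLift Y y)) x)
  /-- `Fbar` is horizontally closed: `d Fbar` vanishes on horizontal vectors. -/
  closed : ∀ (x : E), ∀ u ∈ D.Γ.hor x, ∀ v ∈ D.Γ.hor x, ∀ w ∈ D.Γ.hor x,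
    D.Fbar.extDeriv x u v w = 0

/-- The fibre at `x` of the subbundle
`L = {(X, i_X Fbar) + (V^♯ α, α) | X ∈ Hor, α ∈ Ann(Hor)}` of `TE ⊕ T*E`. -/
def couplingBundle (D : GeometricData HE HB π) (x : E) :
    Submodule ℝ (TangentSpace 𝓘(ℝ, HE) x × Cotangent HE x) where
  carrier := {p | ∃ X ∈ D.Γ.hor x, ∃ α : Cotangent HE x, (∀ Y ∈ D.Γ.hor x, α Y = 0) ∧
    p = (X, D.Fbar.toFun x X) + (D.V.sharp x α, α)}
  zero_mem' := ⟨0, Submodule.zero_mem _, 0, fun _ _ ↦ rfl, by simp; rfl⟩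
  add_mem' := by
    rintro _ _ ⟨X, hX, α, hα, rfl⟩ ⟨Y, hY, β, hβ, rfl⟩
    refine ⟨X + Y, Submodule.add_mem _ hX hY, α + β, fun Z hZ ↦ ?_, ?_⟩
    · simp [hα Z hZ, hβ Z hZ]
    · simp only [map_add, Prod.mk_add_mk, Prod.mk.injEq]
      constructor <;> abel
  smul_mem' := by
    rintro c _ ⟨X, hX, α, hα, rfl⟩
    refine ⟨c • X, Submodule.smul_mem _ c hX, c • α, fun Z hZ ↦ ?_, ?_⟩
    · simp [hα Z hZ]
    · simp

end GeometricData

end Bundles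

end CouplingDirac

end

/-! A pair `(X, ξ)` lies in the coupling bundle `L` if and only if `Γ X = V^♯ ξ` and
`ξ - ξ ∘ Γ = Fbar X`. From these two equations, `L` is a maximal isotropic subbundle of `TE ⊕ T*E`
for the pairing `⟨(X, ξ), (Y, η)⟩ = η X + ξ Y` (`pairing_eq_zero`, `mem_of_forall_pairing`), and it
is the image of the smooth bundle map `(u, α) ↦ (u - Γ u + V^♯ α, Fbar u + α ∘ Γ)`, so that each of
its vectors extends to a smooth section (`exists_section`). Hence the sections of `L` are closed
under the Courant bracket if and only if `⟨[s₁, s₂], s₃⟩ = 0` for all sections `s₁`, `s₂`, `s₃`.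

Differentiating the two equations along a section shows that the component of its derivative
transverse to `L` depends only on its value, through a second fundamental form of `L` built from
the first derivatives of `Γ`, `V` and `Fbar` in a chart. Since `L` is isotropic, `⟨[s₁, s₂], s₃⟩` is
the cyclic sum of this form, a tensor on `L` (`pairing_bracket`). So closedness of `L` is a condition
on the first jet of the data at each point (`isCourantClosed_iff`), and the remaining calculation is
linear algebra in a `GeometricJet`.

The fibres of `L` are spanned by the pairs `(u, Fbar u)` with `u` horizontal and `(V^♯ α, α)` with
`α = α ∘ Γ`. By its cyclic symmetry the tensor vanishes if and only if it does on triples with three,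
two, one or no generators of the second kind (`courantTensor_eq_zero_iff`), and these four
components are the four integrability conditions, in this order:
* half the Schouten bracket `[V, V]` (`courantTensor_ann_eq_jacobiator`), a vertical trivector as
  `Vert` is involutive;
* the Lie derivative of `V` along the lift of a vector field (`courantTensor_eq_lieDeriv`), a
  vertical bivector as horizontal lifts are projectable;
* the pairing of `α` with the difference of `Curv(X, Y)` and
  `V^♯ (d (Fbar (hor X, hor Y)))` (`courantTensor_eq_curvature`);
* the exterior derivative of `Fbar` on horizontal vectors (`courantTensor_hor_hor_hor`).

For the middle two, each horizontal vector must be a value of the horizontal lift of a smooth vector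
field on the base, which holds as `π` is a submersion (`exists_horLift_eq`). Lifts are
differentiable as solutions of a smooth linear system (`differentiableAt_of_apply_eq`). Involutivity
and projectability both come from the symmetry of the second derivative of `π` in charts. -/

open scoped Manifold ContDiff Topology

noncomputable section

namespace CouplingDirac

/-! ### First-order jets of geometric data -/

/-- The first-order jet at a point of the coordinate expressions of geometric data: the values
`Γ`, `V`, `F` of the connection, the bivector field and the horizontal 2-form, and their
derivatives, with the direction of differentiation as first argument. The fields record
the algebraic identities between the values, their derivatives, and, in `invol`, the
involutivity of the vertical bundle. -/
structure GeometricJet (H : Type*) [NormedAddCommGroup H] [NormedSpace ℝ H] where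
  Γ : H →L[ℝ] H
  V : (H →L[ℝ] ℝ) →L[ℝ] H
  F : H →L[ℝ] H →L[ℝ] ℝ
  dΓ : H →L[ℝ] H →L[ℝ] H
  dV : H →L[ℝ] (H →L[ℝ] ℝ) →L[ℝ] H
  dF : H →L[ℝ] H →L[ℝ] H →L[ℝ] ℝ
  idem : ∀ v, Γ (Γ v) = Γ v
  V_skew : ∀ α β : H →L[ℝ] ℝ, β (V α) = -α (V β)
  F_skew : ∀ u v, F u v = -F v u
  Γ_V : ∀ α, Γ (V α) = V α
  F_Γ : ∀ v, F (Γ v) = 0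
  d_idem : ∀ w v, dΓ w (Γ v) + Γ (dΓ w v) = dΓ w v
  dV_skew : ∀ w (α β : H →L[ℝ] ℝ), β (dV w α) = -α (dV w β)
  dF_skew : ∀ w u v, dF w u v = -dF w v u
  d_Γ_V : ∀ w α, dΓ w (V α) + Γ (dV w α) = dV w α
  d_F_Γ : ∀ w v, dF w (Γ v) + F (dΓ w v) = 0
  invol : ∀ v w, Γ v = v → Γ w = w → dΓ v w = dΓ w v

namespace GeometricJet

variable {H : Type*} [NormedAddCommGroup H] [NormedSpace ℝ H] (J : GeometricJet H)

lemma V_comp_Γ (α : H →L[ℝ] ℝ) : J.V (α.comp J.Γ) = J.V α := by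
  refine (SeparatingDual.eq_iff_forall_dual_eq (R := ℝ)).2 fun β ↦ ?_
  rw [J.V_skew, J.V_skew α β, ContinuousLinearMap.comp_apply, J.Γ_V]

lemma F_V (α : H →L[ℝ] ℝ) : J.F (J.V α) = 0 := by rw [← J.Γ_V, J.F_Γ]

lemma F_apply_V (u : H) (α : H →L[ℝ] ℝ) : J.F u (J.V α) = 0 := by
  rw [J.F_skew, J.F_V]; simp

lemma F_apply_Γ (u v : H) : J.F u (J.Γ v) = 0 := by
  rw [J.F_skew, J.F_Γ]; simp

lemma V_F (u : H) : J.V (J.F u) = 0 := by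
  refine (SeparatingDual.eq_zero_iff_forall_dual_eq_zero (R := ℝ) _).2 fun β ↦ ?_
  rw [J.V_skew, J.F_apply_V, neg_zero]

lemma dF_V (w : H) (α : H →L[ℝ] ℝ) : J.dF w (J.V α) = -J.F (J.dV w α) := by
  have h := J.d_F_Γ w (J.V α)
  rw [J.Γ_V] at h
  rw [← J.d_Γ_V, map_add, J.F_Γ, add_zero]
  exact eq_neg_of_add_eq_zero_left h

lemma dF_apply_V (w u : H) (α : H →L[ℝ] ℝ) : J.dF w u (J.V α) = -J.F u (J.dV w α) := by
  rw [J.dF_skew, J.dF_V, J.F_skew]; simp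

/-- By the derivative of `Γ ∘ V = V`, the vectors `dΓ w (V α)` and `dV w α` differ by a vertical
vector, which `F u` does not see. -/
lemma F_dΓ_V (u w : H) (α : H →L[ℝ] ℝ) : J.F u (J.dΓ w (J.V α)) = J.F u (J.dV w α) := by
  rw [← J.d_Γ_V w α, map_add, J.F_apply_Γ, add_zero]

lemma Γ_dΓ_of_vert {v : H} (w : H) (hv : J.Γ v = v) : J.Γ (J.dΓ w v) = 0 := by
  have h := J.d_idem w v
  rwa [hv, add_eq_left] at h

lemma Γ_dΓ_of_hor {u : H} (w : H) (hu : J.Γ u = 0) : J.Γ (J.dΓ w u) = J.dΓ w u := by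
  have h := J.d_idem w u
  rwa [hu, map_zero, zero_add] at h

lemma F_dΓ_of_hor (u' : H) {u : H} (w : H) (hu : J.Γ u = 0) : J.F u' (J.dΓ w u) = 0 := by
  rw [← J.Γ_dΓ_of_hor w hu, J.F_apply_Γ]

/-- Differentiate `F ∘ V = 0` at the covector `F v`, on which `V` vanishes. -/
lemma F_dV_F (u w v : H) : J.F u (J.dV w (J.F v)) = 0 := by
  have h := J.dF_V w (J.F v)
  rw [J.V_F, map_zero, zero_eq_neg] at h
  rw [J.F_skew, h]
  simp

lemma apply_Γ_of_ann {α : H →L[ℝ] ℝ} (hα : ∀ u, J.Γ u = 0 → α u = 0) (v : H) :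
    α (J.Γ v) = α v := by
  have h := hα (v - J.Γ v) (by simp [J.idem])
  rw [map_sub, sub_eq_zero] at h
  exact h.symm

lemma apply_dΓ_V_of_ann {α : H →L[ℝ] ℝ} (hα : ∀ u, J.Γ u = 0 → α u = 0) (w : H)
    (β : H →L[ℝ] ℝ) : α (J.dΓ w (J.V β)) = 0 :=
  hα _ (J.Γ_dΓ_of_vert w (J.Γ_V β))

/-! ### The Courant tensor of the coupling subspace -/

/-- The fibre of the coupling bundle: `(X, ξ)` is of the form `(u, F u) + (V α, α)` with `u`
horizontal and `α` annihilating the horizontal vectors, see `mem_iff`. -/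
def Mem (X : H) (ξ : H →L[ℝ] ℝ) : Prop :=
  J.Γ X = J.V ξ ∧ ∀ v, ξ v - ξ (J.Γ v) = J.F X v

lemma mem_iff (X : H) (ξ : H →L[ℝ] ℝ) : J.Mem X ξ ↔
    ∃ u, J.Γ u = 0 ∧ ∃ α : H →L[ℝ] ℝ, (∀ v, J.Γ v = 0 → α v = 0) ∧
      X = u + J.V α ∧ ξ = J.F u + α := by
  constructor
  · rintro ⟨h1, h2⟩
    refine ⟨X - J.Γ X, by simp [J.idem], ξ.comp J.Γ, fun v hv ↦ by simp [hv], ?_, ?_⟩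
    · rw [J.V_comp_Γ, h1]; abel
    · ext v
      simp [J.F_Γ, ← h2 v]
  · rintro ⟨u, hu, α, hα, rfl, rfl⟩
    refine ⟨by simp [hu, J.Γ_V, J.V_F], fun v ↦ ?_⟩
    simp [J.F_apply_Γ, J.F_V, J.apply_Γ_of_ann hα]

lemma mem_hor {u : H} (hu : J.Γ u = 0) : J.Mem u (J.F u) :=
  ⟨by rw [hu, J.V_F], fun v ↦ by rw [J.F_apply_Γ, sub_zero]⟩

lemma mem_ann {α : H →L[ℝ] ℝ} (hα : ∀ v, J.Γ v = 0 → α v = 0) : J.Mem (J.V α) α :=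
  ⟨J.Γ_V α, fun v ↦ by rw [J.apply_Γ_of_ann hα, J.F_V]; simp⟩

/-- The coupling subspace is isotropic for the pairing of `TE ⊕ T*E`. -/
lemma pairing_eq_zero {X Z : H} {ξ ζ : H →L[ℝ] ℝ} (hX : J.Mem X ξ) (hZ : J.Mem Z ζ) :
    ζ X + ξ Z = 0 := by
  have h1 := hX.2 Z
  have h2 := hZ.2 X
  rw [hZ.1] at h1
  rw [hX.1] at h2
  linear_combination h1 + h2 + J.V_skew ξ ζ + J.F_skew X Z

/-- The coupling subspace contains its annihilator for the pairing of `TE ⊕ T*E`. -/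
lemma mem_of_forall_pairing {X : H} {ξ : H →L[ℝ] ℝ}
    (h : ∀ Z ζ, J.Mem Z ζ → ζ X + ξ Z = 0) : J.Mem X ξ := by
  constructor
  · refine (SeparatingDual.eq_iff_forall_dual_eq (R := ℝ)).2 fun β ↦ ?_
    have h' := h _ _ (J.mem_ann (α := β.comp J.Γ) fun v hv ↦ by simp [hv])
    rw [J.V_comp_Γ, ContinuousLinearMap.comp_apply] at h'
    rw [J.V_skew]
    linarith
  · intro v
    have h' := h _ _ (J.mem_hor (u := v - J.Γ v) (by simp [J.idem]))
    simp only [map_sub, J.F_Γ, sub_zero] at h'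
    rw [J.F_skew]
    linarith

/-- The second fundamental form of the coupling subspace: the pairing with `(Z, ζ)` of the
derivative in the direction `W` of the projection `(u, α) ↦ (u - Γ u + V α, F u + α ∘ Γ)`
onto the coupling subspace, applied to `(Y, η)`. -/
def secondForm (W Y : H) (η : H →L[ℝ] ℝ) (Z : H) (ζ : H →L[ℝ] ℝ) : ℝ :=
  -ζ (J.dΓ W Y) + ζ (J.dV W η) + J.dF W Y Z + η (J.dΓ W Z)

/-- The Courant tensor `⟨[s₁, s₂], s₃⟩` of the coupling subspace. -/
def courantTensor (X : H) (ξ : H →L[ℝ] ℝ) (Y : H) (η : H →L[ℝ] ℝ) (Z : H) (ζ : H →L[ℝ] ℝ) : ℝ :=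
  J.secondForm X Y η Z ζ + J.secondForm Y Z ζ X ξ + J.secondForm Z X ξ Y η

/-- If a section of the coupling bundle has value `(X, ξ)` and derivative `(dX, dξ)`, then the
component of its derivative transverse to the coupling subspace is given by the second
fundamental form. The hypotheses are the derivatives of the two equations in `Mem`. -/
lemma pairing_deriv_eq_secondForm {X : H} {ξ : H →L[ℝ] ℝ} {dX : H →L[ℝ] H}
    {dξ : H →L[ℝ] H →L[ℝ] ℝ}
    (h1 : ∀ w, J.dΓ w X + J.Γ (dX w) = J.dV w ξ + J.V (dξ w))
    (h2 : ∀ w v, dξ w v - dξ w (J.Γ v) - ξ (J.dΓ w v) = J.dF w X v + J.F (dX w) v)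
    {Z : H} {ζ : H →L[ℝ] ℝ} (hZ : J.Mem Z ζ) (w : H) :
    ζ (dX w) + dξ w Z = J.secondForm w X ξ Z ζ := by
  have e1 := congrArg ζ (h1 w)
  have e2 := h2 w Z
  have e3 := hZ.2 (dX w)
  have e4 := J.V_skew (dξ w) ζ
  have e5 := J.F_skew (dX w) Z
  rw [hZ.1] at e2
  simp only [map_add] at e1
  simp only [secondForm]
  linear_combination e1 + e2 + e3 + e4 + e5

/-- The pairing of the Courant bracket of two sections of the coupling bundle with a vector of
the coupling subspace depends only on the values of the sections: it is the Courant tensor. -/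
lemma pairing_bracket {X Y : H} {ξ η : H →L[ℝ] ℝ} {dX dY : H →L[ℝ] H}
    {dξ dη : H →L[ℝ] H →L[ℝ] ℝ} (hY : J.Mem Y η)
    (hX1 : ∀ w, J.dΓ w X + J.Γ (dX w) = J.dV w ξ + J.V (dξ w))
    (hX2 : ∀ w v, dξ w v - dξ w (J.Γ v) - ξ (J.dΓ w v) = J.dF w X v + J.F (dX w) v)
    (hY1 : ∀ w, J.dΓ w Y + J.Γ (dY w) = J.dV w η + J.V (dη w))
    (hY2 : ∀ w v, dη w v - dη w (J.Γ v) - η (J.dΓ w v) = J.dF w Y v + J.F (dY w) v)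
    {Z : H} {ζ : H →L[ℝ] ℝ} (hZ : J.Mem Z ζ) :
    ζ (dY X - dX Y) + (dη X Z + η (dX Z) - (dξ Y Z - dξ Z Y))
      = J.courantTensor X ξ Y η Z ζ := by
  have e1 := J.pairing_deriv_eq_secondForm hY1 hY2 hZ X
  have e2 := J.pairing_deriv_eq_secondForm hX1 hX2 hZ Y
  have e3 := J.pairing_deriv_eq_secondForm hX1 hX2 hY Z
  have e4 : J.secondForm Y Z ζ X ξ = -J.secondForm Y X ξ Z ζ := by
    simp only [secondForm]
    linear_combination J.dV_skew Y ζ ξ + J.dF_skew Y Z X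
  simp only [courantTensor, map_sub]
  linear_combination e1 - e2 + e3 - e4

lemma courantTensor_rotate (X : H) (ξ : H →L[ℝ] ℝ) (Y : H) (η : H →L[ℝ] ℝ) (Z : H)
    (ζ : H →L[ℝ] ℝ) : J.courantTensor X ξ Y η Z ζ = J.courantTensor Y η Z ζ X ξ := by
  simp only [courantTensor]; ring

lemma courantTensor_add_left (X X' : H) (ξ ξ' : H →L[ℝ] ℝ) (Y : H) (η : H →L[ℝ] ℝ) (Z : H)
    (ζ : H →L[ℝ] ℝ) : J.courantTensor (X + X') (ξ + ξ') Y η Z ζ =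
      J.courantTensor X ξ Y η Z ζ + J.courantTensor X' ξ' Y η Z ζ := by
  simp only [courantTensor, secondForm, map_add, add_apply]
  ring

/-! ### The components of the Courant tensor -/

lemma courantTensor_hor_hor_hor {u v w : H} (hu : J.Γ u = 0) (hv : J.Γ v = 0) (hw : J.Γ w = 0) :
    J.courantTensor u (J.F u) v (J.F v) w (J.F w) = J.dF u v w - J.dF v u w + J.dF w u v := by
  have key : ∀ a b c, J.Γ b = 0 → J.Γ c = 0 →
      J.secondForm a b (J.F b) c (J.F c) = J.dF a b c := by
    intro a b c hb hc
    rw [secondForm, J.F_dV_F, J.F_dΓ_of_hor _ _ hb, J.F_dΓ_of_hor _ _ hc]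
    ring
  rw [courantTensor, key _ _ _ hv hw, key _ _ _ hw hu, key _ _ _ hu hv, J.dF_skew v w u]
  ring

/-- The derivative of `Γ` does not contribute here, since it maps vertical vectors to horizontal
ones, and the derivative of `F` does not, since `F` vanishes on vertical vectors. -/
lemma secondForm_ann_ann (w : H) {α β : H →L[ℝ] ℝ} (hα : ∀ u, J.Γ u = 0 → α u = 0)
    (hβ : ∀ u, J.Γ u = 0 → β u = 0) :
    J.secondForm w (J.V α) α (J.V β) β = β (J.dV w α) := by
  rw [secondForm, J.apply_dΓ_V_of_ann hα, J.apply_dΓ_V_of_ann hβ, J.dF_V,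
    neg_apply, J.F_apply_V]
  ring

lemma courantTensor_ann_ann_ann {α β γ : H →L[ℝ] ℝ} (hα : ∀ u, J.Γ u = 0 → α u = 0)
    (hβ : ∀ u, J.Γ u = 0 → β u = 0) (hγ : ∀ u, J.Γ u = 0 → γ u = 0) :
    J.courantTensor (J.V α) α (J.V β) β (J.V γ) γ =
      γ (J.dV (J.V α) β) + α (J.dV (J.V β) γ) + β (J.dV (J.V γ) α) := by
  rw [courantTensor, J.secondForm_ann_ann _ hβ hγ, J.secondForm_ann_ann _ hγ hα,
    J.secondForm_ann_ann _ hα hβ]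

lemma dΓ_V_V (α β : H →L[ℝ] ℝ) : J.dΓ (J.V α) (J.V β) = J.dΓ (J.V β) (J.V α) :=
  J.invol _ _ (J.Γ_V α) (J.Γ_V β)

lemma secondForm_hor_ann (u w : H) (α : H →L[ℝ] ℝ) :
    J.secondForm w u (J.F u) (J.V α) α = -α (J.dΓ w u) - J.F u (J.dV w α) := by
  rw [secondForm, J.dV_skew, J.dF_apply_V, J.F_dΓ_V]
  ring

lemma secondForm_ann_hor (u w : H) (α : H →L[ℝ] ℝ) :
    J.secondForm w (J.V α) α u (J.F u) = α (J.dΓ w u) + J.F u (J.dV w α) := by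
  rw [secondForm, J.dF_skew, J.dF_apply_V, J.F_dΓ_V]
  ring

lemma courantTensor_hor_ann_ann (u : H) {α β : H →L[ℝ] ℝ}
    (hα : ∀ u, J.Γ u = 0 → α u = 0) (hβ : ∀ u, J.Γ u = 0 → β u = 0) :
    J.courantTensor u (J.F u) (J.V α) α (J.V β) β =
      β (J.dV u α) + β (J.dΓ (J.V α) u) - α (J.dΓ (J.V β) u) := by
  rw [courantTensor, J.secondForm_ann_ann _ hα hβ, J.secondForm_ann_hor,
    J.secondForm_hor_ann, ← J.F_dΓ_V u (J.V α), ← J.F_dΓ_V u (J.V β), J.dΓ_V_V]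
  ring

lemma courantTensor_hor_hor_ann {u v : H} (hu : J.Γ u = 0) (hv : J.Γ v = 0) {α : H →L[ℝ] ℝ} :
    J.courantTensor u (J.F u) v (J.F v) (J.V α) α =
      α (J.dΓ v u - J.dΓ u v) + J.dF (J.V α) u v + J.F u (J.dV v α) - J.F v (J.dV u α) := by
  have h : J.secondForm (J.V α) u (J.F u) v (J.F v) = J.dF (J.V α) u v := by
    rw [secondForm, J.F_dV_F, J.F_dΓ_of_hor _ _ hu, J.F_dΓ_of_hor _ _ hv]
    ring
  rw [courantTensor, h, J.secondForm_hor_ann, J.secondForm_ann_hor, map_sub]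
  ring

/-- The Courant tensor of the coupling subspace vanishes if and only if its components on the
two kinds of generators `(u, F u)` and `(V α, α)` do. The covectors annihilating the horizontal
subspace are those of the form `α ∘ Γ`. -/
lemma courantTensor_eq_zero_iff :
    (∀ X ξ Y η Z ζ, J.Mem X ξ → J.Mem Y η → J.Mem Z ζ → J.courantTensor X ξ Y η Z ζ = 0) ↔
      (∀ α β γ : H →L[ℝ] ℝ, J.courantTensor (J.V (α.comp J.Γ)) (α.comp J.Γ)
        (J.V (β.comp J.Γ)) (β.comp J.Γ) (J.V (γ.comp J.Γ)) (γ.comp J.Γ) = 0) ∧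
      (∀ u (α β : H →L[ℝ] ℝ), J.Γ u = 0 → J.courantTensor u (J.F u)
        (J.V (α.comp J.Γ)) (α.comp J.Γ) (J.V (β.comp J.Γ)) (β.comp J.Γ) = 0) ∧
      (∀ u v (α : H →L[ℝ] ℝ), J.Γ u = 0 → J.Γ v = 0 →
        J.courantTensor u (J.F u) v (J.F v) (J.V (α.comp J.Γ)) (α.comp J.Γ) = 0) ∧
      (∀ u v w, J.Γ u = 0 → J.Γ v = 0 → J.Γ w = 0 →
        J.courantTensor u (J.F u) v (J.F v) w (J.F w) = 0) := by
  constructor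
  · intro h
    have hann : ∀ α : H →L[ℝ] ℝ, J.Mem (J.V (α.comp J.Γ)) (α.comp J.Γ) := fun α ↦
      J.mem_ann fun v hv ↦ by simp [hv]
    exact ⟨fun α β γ ↦ h _ _ _ _ _ _ (hann α) (hann β) (hann γ),
      fun u α β hu ↦ h _ _ _ _ _ _ (J.mem_hor hu) (hann α) (hann β),
      fun u v α hu hv ↦ h _ _ _ _ _ _ (J.mem_hor hu) (J.mem_hor hv) (hann α),
      fun u v w hu hv hw ↦ h _ _ _ _ _ _ (J.mem_hor hu) (J.mem_hor hv) (J.mem_hor hw)⟩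
  · rintro ⟨h0, h1, h2, h3⟩ X ξ Y η Z ζ hX hY hZ
    have hann : ∀ {α : H →L[ℝ] ℝ}, (∀ u, J.Γ u = 0 → α u = 0) → α.comp J.Γ = α := fun hα ↦
      ContinuousLinearMap.ext fun v ↦ J.apply_Γ_of_ann hα v
    replace h0 : ∀ α β γ : H →L[ℝ] ℝ, (∀ u, J.Γ u = 0 → α u = 0) → (∀ u, J.Γ u = 0 → β u = 0) →
        (∀ u, J.Γ u = 0 → γ u = 0) → J.courantTensor (J.V α) α (J.V β) β (J.V γ) γ = 0 :=
      fun α β γ hα hβ hγ ↦ by simpa only [hann hα, hann hβ, hann hγ] using h0 α β γ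
    replace h1 : ∀ u (α β : H →L[ℝ] ℝ), J.Γ u = 0 → (∀ u, J.Γ u = 0 → α u = 0) →
        (∀ u, J.Γ u = 0 → β u = 0) → J.courantTensor u (J.F u) (J.V α) α (J.V β) β = 0 :=
      fun u α β hu hα hβ ↦ by simpa only [hann hα, hann hβ] using h1 u α β hu
    replace h2 : ∀ u v (α : H →L[ℝ] ℝ), J.Γ u = 0 → J.Γ v = 0 → (∀ u, J.Γ u = 0 → α u = 0) →
        J.courantTensor u (J.F u) v (J.F v) (J.V α) α = 0 :=
      fun u v α hu hv hα ↦ by simpa only [hann hα] using h2 u v α hu hv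
    obtain ⟨u, hu, α, hα, rfl, rfl⟩ := (J.mem_iff _ _).1 hX
    obtain ⟨v, hv, β, hβ, rfl, rfl⟩ := (J.mem_iff _ _).1 hY
    obtain ⟨w, hw, γ, hγ, rfl, rfl⟩ := (J.mem_iff _ _).1 hZ
    have h1' : ∀ u α β, J.Γ u = 0 → (∀ u, J.Γ u = 0 → α u = 0) → (∀ u, J.Γ u = 0 → β u = 0) →
        J.courantTensor (J.V β) β u (J.F u) (J.V α) α = 0 := fun u α β hu hα hβ ↦ by
      rw [courantTensor_rotate]; exact h1 u α β hu hα hβ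
    have h1'' : ∀ u α β, J.Γ u = 0 → (∀ u, J.Γ u = 0 → α u = 0) → (∀ u, J.Γ u = 0 → β u = 0) →
        J.courantTensor (J.V α) α (J.V β) β u (J.F u) = 0 := fun u α β hu hα hβ ↦ by
      rw [courantTensor_rotate]; exact h1' u α β hu hα hβ
    have h2' : ∀ u v α, J.Γ u = 0 → J.Γ v = 0 → (∀ u, J.Γ u = 0 → α u = 0) →
        J.courantTensor (J.V α) α u (J.F u) v (J.F v) = 0 := fun u v α hu hv hα ↦ by
      rw [courantTensor_rotate]; exact h2 u v α hu hv hα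
    have h2'' : ∀ u v α, J.Γ u = 0 → J.Γ v = 0 → (∀ u, J.Γ u = 0 → α u = 0) →
        J.courantTensor u (J.F u) (J.V α) α v (J.F v) = 0 := fun u v α hu hv hα ↦ by
      rw [courantTensor_rotate]; exact h2' v u α hv hu hα
    have e2 : ∀ X ξ Z ζ, J.courantTensor X ξ (v + J.V β) (J.F v + β) Z ζ =
        J.courantTensor X ξ v (J.F v) Z ζ + J.courantTensor X ξ (J.V β) β Z ζ := by
      intro X ξ Z ζ
      rw [courantTensor_rotate, courantTensor_add_left, J.courantTensor_rotate X,
        J.courantTensor_rotate X]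
    have e3 : ∀ X ξ Y η, J.courantTensor X ξ Y η (w + J.V γ) (J.F w + γ) =
        J.courantTensor X ξ Y η w (J.F w) + J.courantTensor X ξ Y η (J.V γ) γ := by
      intro X ξ Y η
      rw [← courantTensor_rotate, courantTensor_add_left, J.courantTensor_rotate w,
        J.courantTensor_rotate (J.V γ)]
    rw [courantTensor_add_left, e2, e2, e3, e3, e3, e3, h3 u v w hu hv hw, h2 u v γ hu hv hγ,
      h2'' u w β hu hw hβ, h1 u β γ hu hβ hγ, h2' v w α hv hw hα, h1' v γ α hv hγ hα,
      h1'' w α β hw hα hβ, h0 α β γ hα hβ hγ]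
    simp

/-! ### The components in terms of the bivector, the lifts and the curvature -/

/-- Half the Schouten bracket `[V, V]` on three covectors. -/
def jacobiator (α β γ : H →L[ℝ] ℝ) : ℝ :=
  γ (J.dV (J.V α) β) + α (J.dV (J.V β) γ) + β (J.dV (J.V γ) α)

lemma jacobiator_rotate (α β γ : H →L[ℝ] ℝ) : J.jacobiator α β γ = J.jacobiator β γ α := by
  simp only [jacobiator]; ring

/-- The trivector `[V, V]` is vertical because the vertical bundle is involutive. -/
lemma jacobiator_comp_Γ (α β γ : H →L[ℝ] ℝ) :
    J.jacobiator (α.comp J.Γ) β γ = J.jacobiator α β γ := by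
  have h1 := congrArg α (J.d_Γ_V (J.V β) γ)
  have h2 := congrArg α (J.d_Γ_V (J.V γ) β)
  have h3 := congrArg α (J.dΓ_V_V β γ)
  simp only [map_add] at h1 h2
  simp only [jacobiator, J.V_comp_Γ, ContinuousLinearMap.comp_apply,
    J.dV_skew (J.V γ) _ β]
  linear_combination h1 - h2 - h3

lemma courantTensor_ann_eq_jacobiator (α β γ : H →L[ℝ] ℝ) :
    J.courantTensor (J.V (α.comp J.Γ)) (α.comp J.Γ) (J.V (β.comp J.Γ)) (β.comp J.Γ)
      (J.V (γ.comp J.Γ)) (γ.comp J.Γ) = J.jacobiator α β γ := by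
  rw [J.courantTensor_ann_ann_ann (fun u hu ↦ by simp [hu]) (fun u hu ↦ by simp [hu])
    (fun u hu ↦ by simp [hu]), ← jacobiator, J.jacobiator_comp_Γ, J.jacobiator_rotate,
    J.jacobiator_comp_Γ, J.jacobiator_rotate, J.jacobiator_comp_Γ, J.jacobiator_rotate]

/-- `(X, dX)` is the value and the derivative of the horizontal lift of a vector field on the
base: `hor` and `d_hor` are the equation `Γ X = 0` and its derivative, and `proj` expresses that
the field is projectable, i.e. that its brackets with vertical fields are vertical. -/
structure IsHorizontalLift (X : H) (dX : H →L[ℝ] H) : Prop where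
  hor : J.Γ X = 0
  d_hor : ∀ w, J.dΓ w X + J.Γ (dX w) = 0
  proj : ∀ w, J.Γ w = w → dX w - J.Γ (dX w) = J.dΓ X w

variable {J}

/-- The right-hand side is the Lie derivative of `V` along the lift. It is vertical as the lift is
projectable, so that it may be evaluated on `α ∘ Γ` and `β ∘ Γ`, where the Courant tensor gives
the same value. -/
lemma IsHorizontalLift.courantTensor_eq_lieDeriv {X : H} {dX : H →L[ℝ] H}
    (hX : J.IsHorizontalLift X dX) (α β : H →L[ℝ] ℝ) :
    J.courantTensor X (J.F X) (J.V (α.comp J.Γ)) (α.comp J.Γ) (J.V (β.comp J.Γ)) (β.comp J.Γ) =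
      β (J.dV X α) - β (dX (J.V α)) + α (dX (J.V β)) := by
  rw [J.courantTensor_hor_ann_ann _ (fun u hu ↦ by simp [hu]) (fun u hu ↦ by simp [hu])]
  have e1 := congrArg β (J.d_Γ_V X (α.comp J.Γ))
  have e2 := congrArg α (J.d_Γ_V X β)
  have e3 := congrArg β (congrArg J.Γ (hX.d_hor (J.V α)))
  have e4 := congrArg α (congrArg J.Γ (hX.d_hor (J.V β)))
  have e5 := congrArg β (hX.proj _ (J.Γ_V α))
  have e6 := congrArg α (hX.proj _ (J.Γ_V β))
  have e7 := J.dV_skew X (α.comp J.Γ) β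
  simp only [map_add, map_sub, map_zero, J.idem, J.V_comp_Γ, ContinuousLinearMap.comp_apply]
    at e1 e2 e3 e4 e5 e6 e7 ⊢
  linear_combination e1 - e2 + e3 - e4 + e5 - e6 + e7 - J.dV_skew X α β

/-- The difference of the curvature of two horizontal lifts and of `V (d (F (X, Y)))` is a
component of the Courant tensor. -/
lemma IsHorizontalLift.courantTensor_eq_curvature {X Y : H} {dX dY : H →L[ℝ] H}
    (hX : J.IsHorizontalLift X dX) (hY : J.IsHorizontalLift Y dY) {δ : H →L[ℝ] ℝ}
    (hδ : ∀ w, δ w = J.dF w X Y + J.F (dX w) Y + J.F X (dY w)) (α : H →L[ℝ] ℝ) :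
    J.courantTensor X (J.F X) Y (J.F Y) (J.V (α.comp J.Γ)) (α.comp J.Γ) =
      α (J.Γ (dY X - dX Y) - J.V δ) := by
  have key : ∀ {Z : H} {dZ : H →L[ℝ] H} (hZ : J.IsHorizontalLift Z dZ) (u : H),
      J.F u (dZ (J.V α)) = J.F u (J.dV Z (α.comp J.Γ)) := by
    intro Z dZ hZ u
    have h := congrArg (J.F u) (hZ.proj _ (J.Γ_V α))
    rw [map_sub, J.F_apply_Γ, sub_zero] at h
    rw [h, ← J.F_dΓ_V, J.V_comp_Γ]
  rw [J.courantTensor_hor_hor_ann hX.hor hY.hor, J.V_comp_Γ, map_sub α, J.V_skew δ α, hδ,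
    J.F_skew _ Y, key hX, key hY]
  have e1 := congrArg α (congrArg J.Γ (hX.d_hor Y))
  have e2 := congrArg α (congrArg J.Γ (hY.d_hor X))
  simp only [map_add, map_sub, map_zero, J.idem, ContinuousLinearMap.comp_apply] at e1 e2 ⊢
  linear_combination e1 - e2

end GeometricJet

/-! ### Tensor fields in charts -/

section Charts

variable {H : Type*} [NormedAddCommGroup H] [NormedSpace ℝ H]
  {M : Type*} [TopologicalSpace M] [ChartedSpace H M] [IsManifold 𝓘(ℝ, H) ∞ M]

lemma chartDerivInv_chartDeriv {x₀ x : M} (hx : x ∈ (extChartAt 𝓘(ℝ, H) x₀).source)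
    (v : TangentSpace 𝓘(ℝ, H) x) : chartDerivInv x₀ x (chartDeriv x₀ x v) = v := by
  have : IsManifold 𝓘(ℝ, H) 1 M := .of_le (n := ∞) (by simp)
  exact (isInvertible_mfderiv_extChartAt hx).inverse_apply_self v

lemma chartDeriv_chartDerivInv {x₀ x : M} (hx : x ∈ (extChartAt 𝓘(ℝ, H) x₀).source)
    (v : H) : chartDeriv x₀ x (chartDerivInv x₀ x v) = v := by
  have : IsManifold 𝓘(ℝ, H) 1 M := .of_le (n := ∞) (by simp)
  exact (isInvertible_mfderiv_extChartAt hx).self_apply_inverse v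

lemma continuousLinearMapAt_eq_chartDeriv {x₀ x : M}
    (hx : x ∈ (extChartAt 𝓘(ℝ, H) x₀).source) :
    (trivializationAt H (TangentSpace 𝓘(ℝ, H)) x₀).continuousLinearMapAt ℝ x =
      chartDeriv x₀ x := by
  have : IsManifold 𝓘(ℝ, H) 1 M := .of_le (n := ∞) (by simp)
  exact TangentBundle.continuousLinearMapAt_trivializationAt (by simpa using hx)

lemma mem_trivializationAt_baseSet {x₀ x : M} (hx : x ∈ (extChartAt 𝓘(ℝ, H) x₀).source) :
    x ∈ (trivializationAt H (TangentSpace 𝓘(ℝ, H) : M → Type _) x₀).baseSet := by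
  simpa using hx

lemma symmL_eq_chartDerivInv {x₀ x : M}
    (hx : x ∈ (extChartAt 𝓘(ℝ, H) x₀).source) :
    (trivializationAt H (TangentSpace 𝓘(ℝ, H)) x₀).symmL ℝ x = chartDerivInv x₀ x := by
  ext v
  rw [← chartDerivInv_chartDeriv hx
      ((trivializationAt H (TangentSpace 𝓘(ℝ, H)) x₀).symmL ℝ x v),
    ← continuousLinearMapAt_eq_chartDeriv hx,
    Bundle.Trivialization.continuousLinearMapAt_symmL _ (mem_trivializationAt_baseSet hx)]

/-- A vector field read in the chart centred at `x₀`. -/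
def vectorInChart (X : (x : M) → TangentSpace 𝓘(ℝ, H) x) (x₀ : M) (y : H) : H :=
  chartDeriv x₀ ((extChartAt 𝓘(ℝ, H) x₀).symm y) (X ((extChartAt 𝓘(ℝ, H) x₀).symm y))

/-- A field of endomorphisms of `TM` read in the chart centred at `x₀`. -/
def endoInChart (A : (x : M) → TangentSpace 𝓘(ℝ, H) x →L[ℝ] TangentSpace 𝓘(ℝ, H) x)
    (x₀ : M) (y : H) : H →L[ℝ] H :=
  ((chartDeriv x₀ ((extChartAt 𝓘(ℝ, H) x₀).symm y)).comp (A ((extChartAt 𝓘(ℝ, H) x₀).symm y))).comp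
    (chartDerivInv x₀ ((extChartAt 𝓘(ℝ, H) x₀).symm y))

lemma contDiffAt_comp_symm {G : Type*} [NormedAddCommGroup G] [NormedSpace ℝ G] {x₀ : M}
    {f : M → G} (hf : ContMDiffAt 𝓘(ℝ, H) 𝓘(ℝ, G) ∞ f x₀) :
    ContDiffAt ℝ ∞ (f ∘ (extChartAt 𝓘(ℝ, H) x₀).symm) (extChartAt 𝓘(ℝ, H) x₀ x₀) := by
  have h := (contMDiffOn_extChartAt_symm (I := 𝓘(ℝ, H)) (n := ∞) x₀).contMDiffAt
    (extChartAt_target_mem_nhds x₀)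
  refine (ContMDiffAt.comp _ ?_ h).contDiffAt
  rwa [extChartAt_to_inv]

omit [IsManifold 𝓘(ℝ, H) ∞ M] in
lemma eventually_mem_source (x₀ : M) : ∀ᶠ y in 𝓝 (extChartAt 𝓘(ℝ, H) x₀ x₀),
    (extChartAt 𝓘(ℝ, H) x₀).symm y ∈ (extChartAt 𝓘(ℝ, H) x₀).source := by
  filter_upwards [extChartAt_target_mem_nhds (I := 𝓘(ℝ, H)) x₀] with y hy
  exact (extChartAt 𝓘(ℝ, H) x₀).map_target hy

lemma contDiffAt_vectorInChart {X : (x : M) → TangentSpace 𝓘(ℝ, H) x} {x₀ : M}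
    (hX : ContMDiffAt 𝓘(ℝ, H) (𝓘(ℝ, H).prod 𝓘(ℝ, H)) ∞
      (fun x ↦ Bundle.TotalSpace.mk' H x (X x)) x₀) :
    ContDiffAt ℝ ∞ (vectorInChart X x₀) (extChartAt 𝓘(ℝ, H) x₀ x₀) := by
  refine (contDiffAt_comp_symm (Bundle.contMDiffAt_totalSpace.1 hX).2).congr_of_eventuallyEq ?_
  filter_upwards [eventually_mem_source x₀] with y hy
  simp only [vectorInChart, Function.comp, Bundle.TotalSpace.mk']
  rw [← continuousLinearMapAt_eq_chartDeriv hy, Bundle.Trivialization.continuousLinearMapAt_apply,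
    Bundle.Trivialization.coe_linearMapAt_of_mem _ (mem_trivializationAt_baseSet hy)]

lemma contDiffAt_oneFormInChart {ξ : (x : M) → Cotangent H x} (hξ : IsSmoothOneForm ξ) (x₀ : M) :
    ContDiffAt ℝ ∞ (oneFormInChart ξ x₀) (extChartAt 𝓘(ℝ, H) x₀ x₀) := by
  refine (contDiffAt_comp_symm
    ((contMDiffAt_hom_bundle _).1 hξ.contMDiffAt).2).congr_of_eventuallyEq ?_
  filter_upwards [eventually_mem_source x₀] with y hy
  ext v
  simp only [oneFormInChart, Function.comp, ContinuousLinearMap.inCoordinates,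
    ContinuousLinearMap.comp_apply, symmL_eq_chartDerivInv hy]
  simp

lemma cotangent_continuousLinearMapAt {x₀ x : M}
    (hx : x ∈ (extChartAt 𝓘(ℝ, H) x₀).source) (α : Cotangent H x) :
    (trivializationAt (H →L[ℝ] ℝ) (fun x : M ↦ Cotangent H x) x₀).continuousLinearMapAt ℝ x α =
      α.comp (chartDerivInv x₀ x) := by
  rw [Bundle.Trivialization.continuousLinearMapAt_apply,
    Bundle.Trivialization.coe_linearMapAt_of_mem _ (by simpa using hx), ← symmL_eq_chartDerivInv hx]
  change ContinuousLinearMap.inCoordinates H (TangentSpace 𝓘(ℝ, H)) ℝ (Bundle.Trivial M ℝ)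
    x₀ x x₀ x α = _
  ext v
  simp [ContinuousLinearMap.inCoordinates]

lemma cotangent_symmL {x₀ x : M}
    (hx : x ∈ (extChartAt 𝓘(ℝ, H) x₀).source) (a : H →L[ℝ] ℝ) :
    (trivializationAt (H →L[ℝ] ℝ) (fun x : M ↦ Cotangent H x) x₀).symmL ℝ x a =
      a.comp (chartDeriv x₀ x) := by
  have hb : x ∈ (trivializationAt (H →L[ℝ] ℝ) (fun x : M ↦ Cotangent H x) x₀).baseSet := by
    simpa using hx
  have h := cotangent_continuousLinearMapAt hx
    ((trivializationAt (H →L[ℝ] ℝ) (fun x : M ↦ Cotangent H x) x₀).symmL ℝ x a)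
  rw [Bundle.Trivialization.continuousLinearMapAt_symmL _ hb] at h
  ext v
  rw [ContinuousLinearMap.comp_apply]
  conv_rhs => rw [h, ContinuousLinearMap.comp_apply, chartDerivInv_chartDeriv hx]

lemma TwoForm.contDiffAt_inChart (σ : TwoForm H M) (x₀ : M) :
    ContDiffAt ℝ ∞ (σ.inChart x₀) (extChartAt 𝓘(ℝ, H) x₀ x₀) := by
  refine (contDiffAt_comp_symm
    ((contMDiffAt_hom_bundle _).1 σ.smooth.contMDiffAt).2).congr_of_eventuallyEq ?_
  filter_upwards [eventually_mem_source x₀] with y hy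
  ext v w
  simp only [TwoForm.inChart, Function.comp, ContinuousLinearMap.inCoordinates,
    symmL_eq_chartDerivInv hy, ContinuousLinearMap.comp_apply,
    cotangent_continuousLinearMapAt hy]
  rfl

lemma BivectorField.contDiffAt_inChart (V : BivectorField H M) (x₀ : M) :
    ContDiffAt ℝ ∞ (V.inChart x₀) (extChartAt 𝓘(ℝ, H) x₀ x₀) := by
  refine (contDiffAt_comp_symm
    ((contMDiffAt_hom_bundle _).1 V.smooth.contMDiffAt).2).congr_of_eventuallyEq ?_
  filter_upwards [eventually_mem_source x₀] with y hy
  ext v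
  simp only [BivectorField.inChart, Function.comp, ContinuousLinearMap.inCoordinates,
    continuousLinearMapAt_eq_chartDeriv hy, ContinuousLinearMap.comp_apply,
    cotangent_symmL hy]
  rfl

lemma contDiffAt_endoInChart
    {A : (x : M) → TangentSpace 𝓘(ℝ, H) x →L[ℝ] TangentSpace 𝓘(ℝ, H) x}
    (hA : ContMDiff 𝓘(ℝ, H) (𝓘(ℝ, H).prod 𝓘(ℝ, H →L[ℝ] H)) ∞
      (fun x ↦ Bundle.TotalSpace.mk' (H →L[ℝ] H)
      (E := fun x : M ↦ TangentSpace 𝓘(ℝ, H) x →L[ℝ] TangentSpace 𝓘(ℝ, H) x) x (A x))) (x₀ : M) :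
    ContDiffAt ℝ ∞ (endoInChart A x₀) (extChartAt 𝓘(ℝ, H) x₀ x₀) := by
  refine (contDiffAt_comp_symm
    ((contMDiffAt_hom_bundle _).1 hA.contMDiffAt).2).congr_of_eventuallyEq ?_
  filter_upwards [eventually_mem_source x₀] with y hy
  ext v
  simp only [endoInChart, Function.comp, ContinuousLinearMap.inCoordinates,
    continuousLinearMapAt_eq_chartDeriv hy, ContinuousLinearMap.comp_apply,
    symmL_eq_chartDerivInv hy]

/-! ### The differential operators in charts -/

lemma chartDeriv_mlieBracket (X Y : (x : M) → TangentSpace 𝓘(ℝ, H) x) (x : M) :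
    chartDeriv x x (VectorField.mlieBracket 𝓘(ℝ, H) X Y x) =
      fderiv ℝ (vectorInChart Y x) (extChartAt 𝓘(ℝ, H) x x)
        (vectorInChart X x (extChartAt 𝓘(ℝ, H) x x)) -
      fderiv ℝ (vectorInChart X x) (extChartAt 𝓘(ℝ, H) x x)
        (vectorInChart Y x (extChartAt 𝓘(ℝ, H) x x)) := by
  have : IsManifold 𝓘(ℝ, H) 1 M := .of_le (n := ∞) (by simp)
  have key : ∀ Z : (x : M) → TangentSpace 𝓘(ℝ, H) x,
      VectorField.mpullbackWithin 𝓘(ℝ, H) 𝓘(ℝ, H) (extChartAt 𝓘(ℝ, H) x).symm Z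
        (Set.range 𝓘(ℝ, H)) =ᶠ[𝓝 (extChartAt 𝓘(ℝ, H) x x)] vectorInChart Z x := by
    intro Z
    filter_upwards [extChartAt_target_mem_nhds (I := 𝓘(ℝ, H)) x] with y hy
    rw [VectorField.mpullbackWithin_apply, vectorInChart]
    congr 1
    refine ContinuousLinearMap.inverse_eq ?_ ?_
    · exact mfderivWithin_extChartAt_symm_comp_mfderiv_extChartAt hy
    · exact mfderiv_extChartAt_comp_mfderivWithin_extChartAt_symm hy
  rw [← VectorField.mlieBracketWithin_univ, VectorField.mlieBracketWithin_apply]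
  refine (chartDeriv_chartDerivInv (mem_extChartAt_source x) _).trans ?_
  have bracket_eq : ∀ P Q : H → H,
      P =ᶠ[𝓝 (extChartAt 𝓘(ℝ, H) x x)] vectorInChart X x →
      Q =ᶠ[𝓝 (extChartAt 𝓘(ℝ, H) x x)] vectorInChart Y x →
      VectorField.lieBracketWithin ℝ P Q
        ((extChartAt 𝓘(ℝ, H) x).symm ⁻¹' Set.univ ∩ Set.range 𝓘(ℝ, H)) (extChartAt 𝓘(ℝ, H) x x) =
      VectorField.lieBracket ℝ (vectorInChart X x) (vectorInChart Y x)
        (extChartAt 𝓘(ℝ, H) x x) := by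
    intro P Q hP hQ
    rw [Set.preimage_univ, Set.univ_inter, modelWithCornersSelf_coe, Set.range_id,
      VectorField.lieBracketWithin_univ, hP.lieBracket_vectorField_eq hQ]
  exact bracket_eq _ _ (key X) (key Y)

lemma differential_apply {f : M → ℝ} {x : M}
    (hf : DifferentiableAt ℝ (f ∘ (extChartAt 𝓘(ℝ, H) x).symm) (extChartAt 𝓘(ℝ, H) x x))
    (v : TangentSpace 𝓘(ℝ, H) x) :
    differential f x v =
      fderiv ℝ (f ∘ (extChartAt 𝓘(ℝ, H) x).symm) (extChartAt 𝓘(ℝ, H) x x) (chartDeriv x x v) := by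
  have : IsManifold 𝓘(ℝ, H) 1 M := .of_le (n := ∞) (by simp)
  have h1 : HasMFDerivAt 𝓘(ℝ, H) 𝓘(ℝ, H) (extChartAt 𝓘(ℝ, H) x) x (chartDeriv x x) :=
    (mdifferentiableAt_extChartAt (by simp)).hasMFDerivAt
  have h2 := (hf.hasFDerivAt.hasMFDerivAt).comp x h1
  have h3 : f =ᶠ[𝓝 x] (f ∘ (extChartAt 𝓘(ℝ, H) x).symm) ∘ extChartAt 𝓘(ℝ, H) x := by
    filter_upwards [extChartAt_source_mem_nhds (I := 𝓘(ℝ, H)) x] with z hz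
    simp only [Function.comp, (extChartAt 𝓘(ℝ, H) x).left_inv hz]
  have h4 := (h2.congr_of_eventuallyEq h3).mfderiv
  rw [differential, mvfderiv, h4]
  rfl

end Charts

/-! ### Derivatives of evaluations of linear maps -/

section Leibniz

variable {H G K : Type*} [NormedAddCommGroup H] [NormedSpace ℝ H] [NormedAddCommGroup G]
  [NormedSpace ℝ G] [NormedAddCommGroup K] [NormedSpace ℝ K]

lemma fderiv_clm_apply_apply {A : H → G →L[ℝ] K} {g : H → G} {y : H}
    (hA : DifferentiableAt ℝ A y) (hg : DifferentiableAt ℝ g y) (w : H) :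
    fderiv ℝ (fun z ↦ A z (g z)) y w = fderiv ℝ A y w (g y) + A y (fderiv ℝ g y w) := by
  rw [fderiv_clm_apply hA hg]
  simp [add_comm]

lemma fderiv_clm_apply_const {A : H → G →L[ℝ] K} {y : H}
    (hA : DifferentiableAt ℝ A y) (v : G) (w : H) :
    fderiv ℝ (fun z ↦ A z v) y w = fderiv ℝ A y w v := by
  rw [fderiv_clm_apply_apply hA (differentiableAt_const v)]
  simp

lemma clm_apply_fderiv (b : G →L[ℝ] K) {f : H → G} {y : H} (hf : DifferentiableAt ℝ f y) (w : H) :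
    fderiv ℝ (fun z ↦ b (f z)) y w = b (fderiv ℝ f y w) := by
  rw [fderiv_clm_apply_apply (differentiableAt_const b) hf]
  simp

/-- The derivative of an identity `A (g) = k` which holds near a point. -/
lemma fderiv_apply_add_apply_fderiv {A : H → G →L[ℝ] K} {g : H → G} {k : H → K} {y : H}
    (h : ∀ᶠ z in 𝓝 y, A z (g z) = k z) (hA : DifferentiableAt ℝ A y)
    (hg : DifferentiableAt ℝ g y) (w : H) :
    fderiv ℝ A y w (g y) + A y (fderiv ℝ g y w) = fderiv ℝ k y w := by
  rw [← fderiv_clm_apply_apply hA hg, Filter.EventuallyEq.fderiv_eq h]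

end Leibniz

/-! ### Pointwise identities between the tensors -/

section Charts

variable {H : Type*} [NormedAddCommGroup H] [NormedSpace ℝ H]
  {M : Type*} [TopologicalSpace M] [ChartedSpace H M] [IsManifold 𝓘(ℝ, H) ∞ M]

lemma oneFormInChart_apply (ξ : (x : M) → Cotangent H x) {x₀ : M} {y : H}
    (hy : (extChartAt 𝓘(ℝ, H) x₀).symm y ∈ (extChartAt 𝓘(ℝ, H) x₀).source)
    (v : TangentSpace 𝓘(ℝ, H) ((extChartAt 𝓘(ℝ, H) x₀).symm y)) :
    oneFormInChart ξ x₀ y (chartDeriv x₀ _ v) = ξ _ v := by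
  simp only [oneFormInChart, ContinuousLinearMap.comp_apply, chartDerivInv_chartDeriv hy]

lemma TwoForm.inChart_apply (σ : TwoForm H M) {x₀ : M} {y : H}
    (hy : (extChartAt 𝓘(ℝ, H) x₀).symm y ∈ (extChartAt 𝓘(ℝ, H) x₀).source)
    (u v : TangentSpace 𝓘(ℝ, H) ((extChartAt 𝓘(ℝ, H) x₀).symm y)) :
    σ.inChart x₀ y (chartDeriv x₀ _ u) (chartDeriv x₀ _ v) = σ.toFun _ u v := by
  simp only [TwoForm.inChart, ContinuousLinearMap.comp_apply, chartDerivInv_chartDeriv hy,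
    ContinuousLinearMap.precomp_apply]

lemma BivectorField.inChart_apply (V : BivectorField H M) (x₀ : M) (y : H) (a : H →L[ℝ] ℝ) :
    V.inChart x₀ y a = chartDeriv x₀ ((extChartAt 𝓘(ℝ, H) x₀).symm y)
      (V.sharp _ (a.comp (chartDeriv x₀ ((extChartAt 𝓘(ℝ, H) x₀).symm y)))) :=
  rfl

lemma BivectorField.inChart_oneFormInChart (V : BivectorField H M) (ξ : (x : M) → Cotangent H x)
    {x₀ : M} {y : H}
    (hy : (extChartAt 𝓘(ℝ, H) x₀).symm y ∈ (extChartAt 𝓘(ℝ, H) x₀).source) :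
    V.inChart x₀ y (oneFormInChart ξ x₀ y) =
      chartDeriv x₀ ((extChartAt 𝓘(ℝ, H) x₀).symm y) (V.sharp _ (ξ _)) := by
  rw [V.inChart_apply]
  congr 2
  ext v
  exact oneFormInChart_apply ξ hy v

lemma endoInChart_apply (A : (x : M) → TangentSpace 𝓘(ℝ, H) x →L[ℝ] TangentSpace 𝓘(ℝ, H) x)
    {x₀ : M} {y : H}
    (hy : (extChartAt 𝓘(ℝ, H) x₀).symm y ∈ (extChartAt 𝓘(ℝ, H) x₀).source)
    (v : TangentSpace 𝓘(ℝ, H) ((extChartAt 𝓘(ℝ, H) x₀).symm y)) :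
    endoInChart A x₀ y (chartDeriv x₀ _ v) = chartDeriv x₀ _ (A _ v) := by
  simp only [endoInChart, ContinuousLinearMap.comp_apply, chartDerivInv_chartDeriv hy]

lemma chartDeriv_surjective {x₀ x : M} (hx : x ∈ (extChartAt 𝓘(ℝ, H) x₀).source) (w : H) :
    ∃ v, chartDeriv x₀ x v = w :=
  ⟨_, chartDeriv_chartDerivInv hx w⟩

lemma chartDeriv_injective {x₀ x : M} (hx : x ∈ (extChartAt 𝓘(ℝ, H) x₀).source) :
    Function.Injective (chartDeriv (H := H) x₀ x) :=
  Function.LeftInverse.injective (chartDerivInv_chartDeriv hx)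

lemma BivectorField.skew (V : BivectorField H M) (x : M) (α β : Cotangent H x) :
    β (V.sharp x α) = -α (V.sharp x β) := by
  have h := V.alternating x (α + β)
  simp only [map_add, add_apply, V.alternating, zero_add, add_zero] at h
  linarith

lemma TwoForm.skew (σ : TwoForm H M) (x : M) (u v : TangentSpace 𝓘(ℝ, H) x) :
    σ.toFun x u v = -σ.toFun x v u := by
  have h := σ.alternating x (u + v)
  simp only [map_add, add_apply, σ.alternating, zero_add, add_zero] at h
  linarith

end Charts

section Bundles

variable {HE : Type*} [NormedAddCommGroup HE] [NormedSpace ℝ HE]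
  {HB : Type*} [NormedAddCommGroup HB] [NormedSpace ℝ HB]
  {E : Type*} [TopologicalSpace E] [ChartedSpace HE E] [IsManifold 𝓘(ℝ, HE) ∞ E]
  {B : Type*} [TopologicalSpace B] [ChartedSpace HB B]
  {π : E → B}

lemma EhresmannConnection.toFun_eq_self_iff (Γ : EhresmannConnection HE HB π) (x : E)
    (v : TangentSpace 𝓘(ℝ, HE) x) : Γ.toFun x v = v ↔ tangentMap HE HB π x v = 0 := by
  have h : v ∈ LinearMap.range (Γ.toFun x).toLinearMap ↔ tangentMap HE HB π x v = 0 := by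
    rw [Γ.range_eq]; rfl
  rw [← h]
  refine ⟨fun hv ↦ ⟨v, hv⟩, ?_⟩
  rintro ⟨w, rfl⟩
  exact Γ.idem x w

lemma EhresmannConnection.tangentMap_toFun (Γ : EhresmannConnection HE HB π) (x : E)
    (v : TangentSpace 𝓘(ℝ, HE) x) : tangentMap HE HB π x (Γ.toFun x v) = 0 :=
  (Γ.toFun_eq_self_iff x _).1 (Γ.idem x v)

variable (D : GeometricData HE HB π)

lemma GeometricData.toFun_sharp (x : E) (α : Cotangent HE x) :
    D.Γ.toFun x (D.V.sharp x α) = D.V.sharp x α :=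
  (D.Γ.toFun_eq_self_iff x _).2 (D.vertical x α)

lemma GeometricData.Fbar_toFun (x : E) (v : TangentSpace 𝓘(ℝ, HE) x) :
    D.Fbar.toFun x (D.Γ.toFun x v) = 0 :=
  D.horizontal x _ (D.Γ.tangentMap_toFun x v)

lemma GeometricData.Fbar_sharp (x : E) (α : Cotangent HE x) :
    D.Fbar.toFun x (D.V.sharp x α) = 0 :=
  D.horizontal x _ (D.vertical x α)

lemma GeometricData.sharp_comp_toFun (x : E) (α : Cotangent HE x) :
    D.V.sharp x (α.comp (D.Γ.toFun x)) = D.V.sharp x α := by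
  have : SeparatingDual ℝ (TangentSpace 𝓘(ℝ, HE) x) := inferInstanceAs (SeparatingDual ℝ HE)
  refine (SeparatingDual.eq_iff_forall_dual_eq (R := ℝ)).2 fun β ↦ ?_
  rw [D.V.skew, D.V.skew x α β, ContinuousLinearMap.comp_apply, D.toFun_sharp]

lemma GeometricData.sharp_Fbar (x : E) (u : TangentSpace 𝓘(ℝ, HE) x) :
    D.V.sharp x (D.Fbar.toFun x u) = 0 := by
  have : SeparatingDual ℝ (TangentSpace 𝓘(ℝ, HE) x) := inferInstanceAs (SeparatingDual ℝ HE)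
  refine (SeparatingDual.eq_zero_iff_forall_dual_eq_zero (R := ℝ) _).2 fun β ↦ ?_
  rw [D.V.skew, D.Fbar.skew, D.Fbar_sharp]
  simp

/-- The coupling bundle is cut out by two linear equations with smooth coefficients. -/
lemma GeometricData.mem_couplingBundle_iff (x : E) (X : TangentSpace 𝓘(ℝ, HE) x)
    (ξ : Cotangent HE x) : (X, ξ) ∈ D.couplingBundle x ↔
      D.Γ.toFun x X = D.V.sharp x ξ ∧ ∀ v, ξ v - ξ (D.Γ.toFun x v) = D.Fbar.toFun x X v := by
  constructor
  · rintro ⟨u, hu, α, hα, h⟩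
    obtain ⟨rfl, rfl⟩ := Prod.mk.inj h
    have hu' : D.Γ.toFun x u = 0 := hu
    refine ⟨by rw [map_add, hu', D.toFun_sharp, map_add, D.sharp_Fbar], fun v ↦ ?_⟩
    have h1 := hα (v - D.Γ.toFun x v)
      (show D.Γ.toFun x _ = 0 by rw [map_sub, D.Γ.idem, sub_self])
    have h2 : D.Fbar.toFun x u (D.Γ.toFun x v) = 0 := by rw [D.Fbar.skew, D.Fbar_toFun]; simp
    rw [map_sub] at h1
    simp only [add_apply, map_add, D.Fbar_sharp, h2]
    rw [zero_apply]
    linarith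
  · rintro ⟨h1, h2⟩
    refine ⟨X - D.Γ.toFun x X, show D.Γ.toFun x _ = 0 by rw [map_sub, D.Γ.idem, sub_self],
      ξ.comp (D.Γ.toFun x), fun v hv ↦ ?_, ?_⟩
    · rw [ContinuousLinearMap.comp_apply, show D.Γ.toFun x v = 0 from hv, map_zero]
    · refine Prod.ext ?_ ?_
      · simp only [Prod.fst_add]
        rw [D.sharp_comp_toFun, h1]; abel
      · ext v
        simp only [Prod.snd_add, map_sub, D.Fbar_toFun, sub_zero]
        rw [add_apply, ContinuousLinearMap.comp_apply, ← h2 v]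
        ring

variable (HE HB) in
/-- The projection `π` read in the charts centred at `x` and `π x`. -/
def projInChart (π : E → B) (x : E) (y : HE) : HB :=
  extChartAt 𝓘(ℝ, HB) (π x) (π ((extChartAt 𝓘(ℝ, HE) x).symm y))

lemma contDiffAt_projInChart (hπ : ContMDiff 𝓘(ℝ, HE) 𝓘(ℝ, HB) ∞ π) (x : E) :
    ContDiffAt ℝ ∞ (projInChart HE HB π x) (extChartAt 𝓘(ℝ, HE) x x) :=
  contDiffAt_comp_symm ((contMDiffAt_extChartAt (n := ∞)).comp x hπ.contMDiffAt)

variable [IsManifold 𝓘(ℝ, HB) ∞ B]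

lemma eventually_fderiv_projInChart (hπ : ContMDiff 𝓘(ℝ, HE) 𝓘(ℝ, HB) ∞ π) (x : E) :
    ∀ᶠ y in 𝓝 (extChartAt 𝓘(ℝ, HE) x x),
      ∀ v, fderiv ℝ (projInChart HE HB π x) y
          (chartDeriv x ((extChartAt 𝓘(ℝ, HE) x).symm y) v) =
        chartDeriv (π x) (π ((extChartAt 𝓘(ℝ, HE) x).symm y))
          (tangentMap HE HB π ((extChartAt 𝓘(ℝ, HE) x).symm y) v) := by
  have : IsManifold 𝓘(ℝ, HB) 1 B := .of_le (n := ∞) (by simp)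
  have h0 : ContinuousAt (fun y ↦ π ((extChartAt 𝓘(ℝ, HE) x).symm y))
      (extChartAt 𝓘(ℝ, HE) x x) :=
    hπ.continuous.continuousAt.comp (continuousAt_extChartAt_symm x)
  have h1 := h0.preimage_mem_nhds (t := (extChartAt 𝓘(ℝ, HB) (π x)).source) (by
    rw [extChartAt_to_inv]; exact extChartAt_source_mem_nhds (π x))
  have h2 := ((contDiffAt_projInChart hπ x).of_le (m := 1) (by simp)).eventually (by simp)
  filter_upwards [extChartAt_target_mem_nhds (I := 𝓘(ℝ, HE)) x, h1, h2] with y hy hy' hy'' v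
  have hz := (extChartAt 𝓘(ℝ, HE) x).map_target hy
  have hdB : HasMFDerivAt 𝓘(ℝ, HB) 𝓘(ℝ, HB) (extChartAt 𝓘(ℝ, HB) (π x))
      (π ((extChartAt 𝓘(ℝ, HE) x).symm y)) (chartDeriv (π x) _) :=
    (mdifferentiableAt_extChartAt (by simpa using hy')).hasMFDerivAt
  have hdE : HasMFDerivAt 𝓘(ℝ, HE) 𝓘(ℝ, HE) (extChartAt 𝓘(ℝ, HE) x)
      ((extChartAt 𝓘(ℝ, HE) x).symm y) (chartDeriv x _) :=
    (mdifferentiableAt_extChartAt (by simpa using hz)).hasMFDerivAt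
  have hp : HasMFDerivAt 𝓘(ℝ, HE) 𝓘(ℝ, HB) π ((extChartAt 𝓘(ℝ, HE) x).symm y)
      (tangentMap HE HB π _) :=
    (hπ.contMDiffAt.mdifferentiableAt (by simp)).hasMFDerivAt
  have hq : HasFDerivAt (projInChart HE HB π x) (fderiv ℝ (projInChart HE HB π x) y)
      (extChartAt 𝓘(ℝ, HE) x ((extChartAt 𝓘(ℝ, HE) x).symm y)) := by
    rw [(extChartAt 𝓘(ℝ, HE) x).right_inv hy]
    exact (hy''.differentiableAt (by simp)).hasFDerivAt
  have e1 := hq.hasMFDerivAt.comp _ hdE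
  have e2 : projInChart HE HB π x ∘ extChartAt 𝓘(ℝ, HE) x
      =ᶠ[𝓝 ((extChartAt 𝓘(ℝ, HE) x).symm y)] extChartAt 𝓘(ℝ, HB) (π x) ∘ π := by
    filter_upwards [(isOpen_extChartAt_source (I := 𝓘(ℝ, HE)) x).mem_nhds hz] with z' hz'
    simp only [Function.comp, projInChart, (extChartAt 𝓘(ℝ, HE) x).left_inv hz']
  exact congrArg (fun A ↦ A v)
    (hasMFDerivAt_unique (e1.congr_of_eventuallyEq e2.symm) (hdB.comp _ hp))

end Bundles

/-! ### The jet of geometric data -/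

section Bundles

variable {HE : Type*} [NormedAddCommGroup HE] [NormedSpace ℝ HE]
  {HB : Type*} [NormedAddCommGroup HB] [NormedSpace ℝ HB]
  {E : Type*} [TopologicalSpace E] [ChartedSpace HE E] [IsManifold 𝓘(ℝ, HE) ∞ E]
  {B : Type*} [TopologicalSpace B] [ChartedSpace HB B]
  {π : E → B} (D : GeometricData HE HB π)

section InChart

variable {x : E} {y : HE}
  (hy : (extChartAt 𝓘(ℝ, HE) x).symm y ∈ (extChartAt 𝓘(ℝ, HE) x).source)
include hy

lemma GeometricData.inChart_idem (v : HE) :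
    endoInChart D.Γ.toFun x y (endoInChart D.Γ.toFun x y v) = endoInChart D.Γ.toFun x y v := by
  obtain ⟨v, rfl⟩ := chartDeriv_surjective hy v
  rw [endoInChart_apply _ hy, endoInChart_apply _ hy, D.Γ.idem]

lemma TwoForm.inChart_skew (σ : TwoForm HE E) (u v : HE) :
    σ.inChart x y u v = -σ.inChart x y v u := by
  obtain ⟨u, rfl⟩ := chartDeriv_surjective hy u
  obtain ⟨v, rfl⟩ := chartDeriv_surjective hy v
  rw [σ.inChart_apply hy, σ.inChart_apply hy, σ.skew]

lemma GeometricData.inChart_Γ_V (a : HE →L[ℝ] ℝ) :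
    endoInChart D.Γ.toFun x y (D.V.inChart x y a) = D.V.inChart x y a := by
  rw [D.V.inChart_apply, endoInChart_apply _ hy, D.toFun_sharp]

lemma GeometricData.inChart_F_Γ (v : HE) :
    D.Fbar.inChart x y (endoInChart D.Γ.toFun x y v) = 0 := by
  obtain ⟨v, rfl⟩ := chartDeriv_surjective hy v
  ext w
  obtain ⟨w, rfl⟩ := chartDeriv_surjective hy w
  rw [endoInChart_apply _ hy, D.Fbar.inChart_apply hy, D.Fbar_toFun]
  rfl

end InChart

lemma BivectorField.inChart_skew (V : BivectorField HE E) (x : E) (y : HE) (a b : HE →L[ℝ] ℝ) :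
    b (V.inChart x y a) = -a (V.inChart x y b) := by
  rw [V.inChart_apply, V.inChart_apply]
  exact V.skew _ (a.comp _) (b.comp _)

/-- The derivative of the identity `Γ ∘ Γ = Γ`. -/
lemma GeometricData.fderiv_endoInChart_idem (D : GeometricData HE HB π) (x : E) (w v : HE) :
    fderiv ℝ (endoInChart D.Γ.toFun x) (extChartAt 𝓘(ℝ, HE) x x) w
        (endoInChart D.Γ.toFun x (extChartAt 𝓘(ℝ, HE) x x) v) +
      endoInChart D.Γ.toFun x (extChartAt 𝓘(ℝ, HE) x x)
        (fderiv ℝ (endoInChart D.Γ.toFun x) (extChartAt 𝓘(ℝ, HE) x x) w v) =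
    fderiv ℝ (endoInChart D.Γ.toFun x) (extChartAt 𝓘(ℝ, HE) x x) w v := by
  have hd := (contDiffAt_endoInChart D.Γ.smooth x).differentiableAt (by simp)
  have h := fderiv_apply_add_apply_fderiv
    ((eventually_mem_source x).mono fun y hy ↦ D.inChart_idem hy v)
    hd (hd.clm_apply (differentiableAt_const v)) w
  rwa [fderiv_clm_apply_const hd] at h

variable [IsManifold 𝓘(ℝ, HB) ∞ B]

lemma GeometricData.eventually_fderiv_projInChart_Γ (hπ : ContMDiff 𝓘(ℝ, HE) 𝓘(ℝ, HB) ∞ π)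
    (x : E) : ∀ᶠ y in 𝓝 (extChartAt 𝓘(ℝ, HE) x x), ∀ v,
      fderiv ℝ (projInChart HE HB π x) y (endoInChart D.Γ.toFun x y v) = 0 := by
  filter_upwards [eventually_mem_source x, eventually_fderiv_projInChart hπ x] with y hy h v
  obtain ⟨v, rfl⟩ := chartDeriv_surjective hy v
  rw [endoInChart_apply _ hy, h, D.Γ.tangentMap_toFun, map_zero]

lemma GeometricData.endoInChart_eq_self_of_fderiv (hπ : ContMDiff 𝓘(ℝ, HE) 𝓘(ℝ, HB) ∞ π)
    (x : E) : ∀ᶠ y in 𝓝 (extChartAt 𝓘(ℝ, HE) x x), ∀ v,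
      fderiv ℝ (projInChart HE HB π x) y v = 0 → endoInChart D.Γ.toFun x y v = v := by
  have h0 : ContinuousAt (fun y ↦ π ((extChartAt 𝓘(ℝ, HE) x).symm y))
      (extChartAt 𝓘(ℝ, HE) x x) :=
    hπ.continuous.continuousAt.comp (continuousAt_extChartAt_symm x)
  have h1 := h0.preimage_mem_nhds (t := (extChartAt 𝓘(ℝ, HB) (π x)).source) (by
    rw [extChartAt_to_inv]; exact extChartAt_source_mem_nhds (π x))
  filter_upwards [eventually_mem_source x, eventually_fderiv_projInChart hπ x, h1]
    with y hy h hy' v hv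
  obtain ⟨v, rfl⟩ := chartDeriv_surjective hy v
  rw [h] at hv
  rw [endoInChart_apply _ hy, (D.Γ.toFun_eq_self_iff _ v).2]
  exact chartDeriv_injective hy' (hv.trans (map_zero _).symm)

omit [IsManifold 𝓘(ℝ, HB) ∞ B] in
lemma differentiableAt_fderiv_projInChart (hπ : ContMDiff 𝓘(ℝ, HE) 𝓘(ℝ, HB) ∞ π) (x : E) :
    DifferentiableAt ℝ (fderiv ℝ (projInChart HE HB π x)) (extChartAt 𝓘(ℝ, HE) x x) :=
  ((contDiffAt_projInChart hπ x).fderiv_right (m := 1) (by norm_cast)).differentiableAt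
    (by simp)

omit [IsManifold 𝓘(ℝ, HB) ∞ B] in
lemma isSymmSndFDerivAt_projInChart (hπ : ContMDiff 𝓘(ℝ, HE) 𝓘(ℝ, HB) ∞ π) (x : E) :
    IsSymmSndFDerivAt ℝ (projInChart HE HB π x) (extChartAt 𝓘(ℝ, HE) x x) :=
  (contDiffAt_projInChart hπ x).isSymmSndFDerivAt
    (by rw [minSmoothness_of_isRCLikeNormedField]; exact WithTop.coe_le_coe.2 le_top)

/-- The derivative of the identity `Tπ ∘ Γ = 0`. -/
lemma GeometricData.sndFDeriv_projInChart_Γ (hπ : ContMDiff 𝓘(ℝ, HE) 𝓘(ℝ, HB) ∞ π) (x : E)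
    (w v : HE) :
    fderiv ℝ (fderiv ℝ (projInChart HE HB π x)) (extChartAt 𝓘(ℝ, HE) x x) w
        (endoInChart D.Γ.toFun x (extChartAt 𝓘(ℝ, HE) x x) v) +
      fderiv ℝ (projInChart HE HB π x) (extChartAt 𝓘(ℝ, HE) x x)
        (fderiv ℝ (endoInChart D.Γ.toFun x) (extChartAt 𝓘(ℝ, HE) x x) w v) = 0 := by
  have hd := (contDiffAt_endoInChart D.Γ.smooth x).differentiableAt (by simp)
  have h := fderiv_apply_add_apply_fderiv
    ((D.eventually_fderiv_projInChart_Γ hπ x).mono fun y hy ↦ hy v)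
    (differentiableAt_fderiv_projInChart hπ x) (hd.clm_apply (differentiableAt_const v)) w
  rw [fderiv_clm_apply_const hd] at h
  simpa using h

/-- The jet at `x` of geometric data, read in the chart centred at `x`. -/
def GeometricData.jet (hπ : ContMDiff 𝓘(ℝ, HE) 𝓘(ℝ, HB) ∞ π) (x : E) : GeometricJet HE where
  Γ := endoInChart D.Γ.toFun x (extChartAt 𝓘(ℝ, HE) x x)
  V := D.V.inChart x (extChartAt 𝓘(ℝ, HE) x x)
  F := D.Fbar.inChart x (extChartAt 𝓘(ℝ, HE) x x)
  dΓ := fderiv ℝ (endoInChart D.Γ.toFun x) (extChartAt 𝓘(ℝ, HE) x x)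
  dV := fderiv ℝ (D.V.inChart x) (extChartAt 𝓘(ℝ, HE) x x)
  dF := fderiv ℝ (D.Fbar.inChart x) (extChartAt 𝓘(ℝ, HE) x x)
  idem := (eventually_mem_source x).self_of_nhds |> D.inChart_idem
  V_skew := D.V.inChart_skew x _
  F_skew := (eventually_mem_source x).self_of_nhds |> D.Fbar.inChart_skew
  Γ_V := (eventually_mem_source x).self_of_nhds |> D.inChart_Γ_V
  F_Γ := (eventually_mem_source x).self_of_nhds |> D.inChart_F_Γ
  d_idem := D.fderiv_endoInChart_idem x
  dV_skew w a b := by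
    have hd := (D.V.contDiffAt_inChart x).differentiableAt (by simp)
    have h := DFunLike.congr_fun (congrArg (fun f ↦ fderiv ℝ f (extChartAt 𝓘(ℝ, HE) x x))
      (funext fun y ↦ D.V.inChart_skew x y a b)) w
    rw [fderiv_fun_neg, neg_apply, clm_apply_fderiv b (hd.clm_apply (differentiableAt_const a)),
      clm_apply_fderiv a (hd.clm_apply (differentiableAt_const b)), fderiv_clm_apply_const hd,
      fderiv_clm_apply_const hd] at h
    exact h
  dF_skew w u v := by
    have hd := (D.Fbar.contDiffAt_inChart x).differentiableAt (by simp)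
    have h := fderiv_apply_add_apply_fderiv
      ((eventually_mem_source x).mono fun y hy ↦ D.Fbar.inChart_skew hy u v)
      (hd.clm_apply (differentiableAt_const u)) (differentiableAt_const v) w
    rw [fderiv_fun_neg, neg_apply, fderiv_clm_apply_const (hd.clm_apply (differentiableAt_const v)),
      fderiv_clm_apply_const hd, fderiv_clm_apply_const hd] at h
    simpa using h
  d_Γ_V w a := by
    have hV := (D.V.contDiffAt_inChart x).differentiableAt (by simp)
    have h := fderiv_apply_add_apply_fderiv
      ((eventually_mem_source x).mono fun y hy ↦ D.inChart_Γ_V hy a)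
      ((contDiffAt_endoInChart D.Γ.smooth x).differentiableAt (by simp))
      (hV.clm_apply (differentiableAt_const a)) w
    rwa [fderiv_clm_apply_const hV] at h
  d_F_Γ w v := by
    have hd := (contDiffAt_endoInChart D.Γ.smooth x).differentiableAt (by simp)
    have h := fderiv_apply_add_apply_fderiv
      ((eventually_mem_source x).mono fun y hy ↦ D.inChart_F_Γ hy v)
      ((D.Fbar.contDiffAt_inChart x).differentiableAt (by simp))
      (hd.clm_apply (differentiableAt_const v)) w
    rw [fderiv_clm_apply_const hd] at h
    simpa using h
  invol v w hv hw := by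
    -- The difference is killed by `Tπ`, by the symmetry of the second derivative of the
    -- projection, hence vertical; by `d_idem` it is also horizontal.
    have h1 := D.sndFDeriv_projInChart_Γ hπ x v w
    have h2 := D.sndFDeriv_projInChart_Γ hπ x w v
    rw [hw] at h1
    rw [hv, isSymmSndFDerivAt_projInChart hπ x w v] at h2
    have h3 := (D.endoInChart_eq_self_of_fderiv hπ x).self_of_nhds
      (fderiv ℝ (endoInChart D.Γ.toFun x) (extChartAt 𝓘(ℝ, HE) x x) v w -
        fderiv ℝ (endoInChart D.Γ.toFun x) (extChartAt 𝓘(ℝ, HE) x x) w v)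
      (by rw [map_sub, sub_eq_zero]; exact add_left_cancel (h1.trans h2.symm))
    have h4 : ∀ v w, endoInChart D.Γ.toFun x (extChartAt 𝓘(ℝ, HE) x x) w = w →
        endoInChart D.Γ.toFun x (extChartAt 𝓘(ℝ, HE) x x)
          (fderiv ℝ (endoInChart D.Γ.toFun x) (extChartAt 𝓘(ℝ, HE) x x) v w) = 0 := by
      intro v w hw
      have h := D.fderiv_endoInChart_idem x v w
      rwa [hw, add_eq_left] at h
    rw [map_sub, h4 v w hw, h4 w v hv, sub_zero] at h3
    exact (sub_eq_zero.1 h3.symm)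

end Bundles

/-! ### Tensors and Lie derivatives at the centre of a chart -/

section Charts

variable {H : Type*} [NormedAddCommGroup H] [NormedSpace ℝ H]
  {M : Type*} [TopologicalSpace M] [ChartedSpace H M] [IsManifold 𝓘(ℝ, H) ∞ M]

omit [IsManifold 𝓘(ℝ, H) ∞ M] in
lemma vectorInChart_self (X : (x : M) → TangentSpace 𝓘(ℝ, H) x) (x : M) :
    vectorInChart X x (extChartAt 𝓘(ℝ, H) x x) = chartDeriv x x (X x) := by
  rw [vectorInChart, extChartAt_to_inv]

omit [IsManifold 𝓘(ℝ, H) ∞ M] in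
lemma oneFormInChart_self (ξ : (x : M) → Cotangent H x) (x : M) :
    oneFormInChart ξ x (extChartAt 𝓘(ℝ, H) x x) = (ξ x).comp (chartDerivInv x x) := by
  simp only [oneFormInChart]
  rw [extChartAt_to_inv]

lemma comp_chartDerivInv_apply (x : M) (α : Cotangent H x) (v : TangentSpace 𝓘(ℝ, H) x) :
    α.comp (chartDerivInv x x) (chartDeriv x x v) = α v := by
  rw [ContinuousLinearMap.comp_apply, chartDerivInv_chartDeriv (mem_extChartAt_source x)]

lemma exists_comp_chartDerivInv_eq (x : M) (a : H →L[ℝ] ℝ) :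
    ∃ α : Cotangent H x, α.comp (chartDerivInv x x) = a := by
  refine ⟨a.comp (chartDeriv x x), ?_⟩
  ext u
  simp only [ContinuousLinearMap.comp_apply, chartDeriv_chartDerivInv (mem_extChartAt_source x)]

lemma BivectorField.inChart_self (V : BivectorField H M) (x : M) (α : Cotangent H x) :
    V.inChart x (extChartAt 𝓘(ℝ, H) x x) (α.comp (chartDerivInv x x)) =
      chartDeriv x x (V.sharp x α) := by
  rw [V.inChart_apply, extChartAt_to_inv]
  congr 2
  ext v
  exact comp_chartDerivInv_apply x α v

lemma TwoForm.inChart_self (σ : TwoForm H M) (x : M) (u v : TangentSpace 𝓘(ℝ, H) x) :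
    σ.inChart x (extChartAt 𝓘(ℝ, H) x x) (chartDeriv x x u) (chartDeriv x x v) =
      σ.toFun x u v := by
  simp only [TwoForm.inChart]
  rw [extChartAt_to_inv]
  simp only [ContinuousLinearMap.comp_apply, ContinuousLinearMap.precomp_apply,
    chartDerivInv_chartDeriv (mem_extChartAt_source x)]

lemma endoInChart_self (A : (x : M) → TangentSpace 𝓘(ℝ, H) x →L[ℝ] TangentSpace 𝓘(ℝ, H) x)
    (x : M) (v : TangentSpace 𝓘(ℝ, H) x) :
    endoInChart A x (extChartAt 𝓘(ℝ, H) x x) (chartDeriv x x v) = chartDeriv x x (A x v) := by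
  rw [endoInChart, extChartAt_to_inv]
  simp only [ContinuousLinearMap.comp_apply, chartDerivInv_chartDeriv (mem_extChartAt_source x)]

omit [IsManifold 𝓘(ℝ, H) ∞ M] in
lemma extDerivOne_apply (ξ : (x : M) → Cotangent H x) (x : M) (u v : TangentSpace 𝓘(ℝ, H) x) :
    extDerivOne ξ x u v =
      fderiv ℝ (oneFormInChart ξ x) (extChartAt 𝓘(ℝ, H) x x) (chartDeriv x x u) (chartDeriv x x v) -
      fderiv ℝ (oneFormInChart ξ x) (extChartAt 𝓘(ℝ, H) x x) (chartDeriv x x v)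
        (chartDeriv x x u) :=
  rfl

lemma lieDerivOneForm_apply {X : (x : M) → TangentSpace 𝓘(ℝ, H) x} {ξ : (x : M) → Cotangent H x}
    {x : M} (hX : DifferentiableAt ℝ (vectorInChart X x) (extChartAt 𝓘(ℝ, H) x x))
    (hξ : DifferentiableAt ℝ (oneFormInChart ξ x) (extChartAt 𝓘(ℝ, H) x x))
    (v : TangentSpace 𝓘(ℝ, H) x) :
    lieDerivOneForm X ξ x v =
      fderiv ℝ (oneFormInChart ξ x) (extChartAt 𝓘(ℝ, H) x x)
        (vectorInChart X x (extChartAt 𝓘(ℝ, H) x x)) (chartDeriv x x v) +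
      oneFormInChart ξ x (extChartAt 𝓘(ℝ, H) x x)
        (fderiv ℝ (vectorInChart X x) (extChartAt 𝓘(ℝ, H) x x) (chartDeriv x x v)) := by
  have h : (fun y ↦ ξ y (X y)) ∘ (extChartAt 𝓘(ℝ, H) x).symm =ᶠ[𝓝 (extChartAt 𝓘(ℝ, H) x x)]
      fun y ↦ oneFormInChart ξ x y (vectorInChart X x y) := by
    filter_upwards [eventually_mem_source x] with y hy
    exact (oneFormInChart_apply ξ hy _).symm
  have hd := (hξ.clm_apply hX).congr_of_eventuallyEq h
  rw [lieDerivOneForm, add_apply, differential_apply hd, h.fderiv_eq,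
    fderiv_clm_apply_apply hξ hX, extDerivOne_apply, vectorInChart_self]
  ring

/-- The derivatives of `α` and `β` cancel: the Lie derivative of a bivector field is tensorial in
the 1-forms. -/
lemma BivectorField.lieDeriv_eq (V : BivectorField H M) {X : (x : M) → TangentSpace 𝓘(ℝ, H) x}
    {α β : (x : M) → Cotangent H x} {x : M}
    (hX : DifferentiableAt ℝ (vectorInChart X x) (extChartAt 𝓘(ℝ, H) x x))
    (hα : DifferentiableAt ℝ (oneFormInChart α x) (extChartAt 𝓘(ℝ, H) x x))
    (hβ : DifferentiableAt ℝ (oneFormInChart β x) (extChartAt 𝓘(ℝ, H) x x)) :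
    V.lieDeriv X α β x =
      (β x).comp (chartDerivInv x x) (fderiv ℝ (V.inChart x) (extChartAt 𝓘(ℝ, H) x x)
        (vectorInChart X x (extChartAt 𝓘(ℝ, H) x x)) ((α x).comp (chartDerivInv x x))) -
      (β x).comp (chartDerivInv x x) (fderiv ℝ (vectorInChart X x) (extChartAt 𝓘(ℝ, H) x x)
        (V.inChart x (extChartAt 𝓘(ℝ, H) x x) ((α x).comp (chartDerivInv x x)))) +
      (α x).comp (chartDerivInv x x) (fderiv ℝ (vectorInChart X x) (extChartAt 𝓘(ℝ, H) x x)
        (V.inChart x (extChartAt 𝓘(ℝ, H) x x) ((β x).comp (chartDerivInv x x)))) := by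
  have hV := (V.contDiffAt_inChart x).differentiableAt (by simp)
  have h : (fun y ↦ V.eval y (α y) (β y)) ∘ (extChartAt 𝓘(ℝ, H) x).symm
      =ᶠ[𝓝 (extChartAt 𝓘(ℝ, H) x x)]
      fun y ↦ oneFormInChart β x y (V.inChart x y (oneFormInChart α x y)) := by
    filter_upwards [eventually_mem_source x] with y hy
    rw [V.inChart_oneFormInChart α hy, oneFormInChart_apply β hy]
    rfl
  have hd := (hβ.clm_apply (hV.clm_apply hα)).congr_of_eventuallyEq h
  have e1 : V.eval x (lieDerivOneForm X α x) (β x) =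
      -lieDerivOneForm X α x (V.sharp x (β x)) := V.skew x _ _
  have e2 : V.eval x (α x) (lieDerivOneForm X β x) =
      lieDerivOneForm X β x (V.sharp x (α x)) := rfl
  rw [BivectorField.lieDeriv, e1, e2, lieDerivOneForm_apply hX hα, lieDerivOneForm_apply hX hβ,
    differential_apply hd, h.fderiv_eq, fderiv_clm_apply_apply hβ (hV.clm_apply hα),
    fderiv_clm_apply_apply hV hα, ← V.inChart_self, ← V.inChart_self, ← oneFormInChart_self,
    ← oneFormInChart_self, ← vectorInChart_self, map_add]
  have e3 := V.inChart_skew x (extChartAt 𝓘(ℝ, H) x x)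
    (fderiv ℝ (oneFormInChart α x) (extChartAt 𝓘(ℝ, H) x x)
      (vectorInChart X x (extChartAt 𝓘(ℝ, H) x x)))
    (oneFormInChart β x (extChartAt 𝓘(ℝ, H) x x))
  linear_combination e3

open Bundle in
/-- Every vector of a fibre of a smooth vector bundle extends to a smooth section. -/
lemma exists_contMDiff_section [FiniteDimensional ℝ H] [T2Space M] {F : Type*}
    [NormedAddCommGroup F] [NormedSpace ℝ F] (W : M → Type*) [TopologicalSpace (TotalSpace F W)]
    [∀ x, AddCommGroup (W x)] [∀ x, Module ℝ (W x)] [∀ x, TopologicalSpace (W x)]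
    [FiberBundle F W] [VectorBundle ℝ F W] [ContMDiffVectorBundle ∞ F W 𝓘(ℝ, H)]
    {x : M} (w : W x) : ∃ s : (x : M) → W x, s x = w ∧
      ContMDiff 𝓘(ℝ, H) (𝓘(ℝ, H).prod 𝓘(ℝ, F)) ∞ fun x ↦ TotalSpace.mk' F x (s x) := by
  obtain ⟨u, hu, hs⟩ := FiberBundle.exists_contMDiffOn_extend (k := ∞) 𝓘(ℝ, H) F w
  obtain ⟨t, htu, ht, hxt⟩ := mem_nhds_iff.1 hu
  obtain ⟨ψ, hψ, -⟩ := (SmoothBumpFunction.nhds_basis_support (I := 𝓘(ℝ, H))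
    (ht.mem_nhds hxt)).mem_iff.1 (ht.mem_nhds hxt)
  refine ⟨(ψ : M → ℝ) • FiberBundle.extend F w, ?_, ?_⟩
  · simp
  · exact ContMDiffOn.smul_section_of_tsupport ψ.contMDiff.contMDiffOn ht hψ (hs.mono htu)

end Charts

/-! ### Submersions -/

section Bundles

variable {HE : Type*} [NormedAddCommGroup HE] [NormedSpace ℝ HE]
  {HB : Type*} [NormedAddCommGroup HB] [NormedSpace ℝ HB]
  {E : Type*} [TopologicalSpace E] [ChartedSpace HE E]
  {B : Type*} [TopologicalSpace B] [ChartedSpace HB B] {π : E → B}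

/-- The projection of a smooth fibre bundle is a submersion: through every point passes a smooth
local section. -/
lemma IsSmoothFiberBundle.tangentMap_surjective {HF : Type*} [NormedAddCommGroup HF]
    [NormedSpace ℝ HF] {F : Type*} [TopologicalSpace F] [ChartedSpace HF F]
    (hπ : IsSmoothFiberBundle HE HB HF F π) (z : E) :
    Function.Surjective (tangentMap HE HB π z) := by
  obtain ⟨e, he, -, hs⟩ := hπ.2 (π z)
  have hz : z ∈ e.source := e.mem_source.2 he
  let s : B → E := fun b ↦ e.toOpenPartialHomeomorph.symm (b, (e z).2)
  have hsz : s (π z) = z := by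
    have h : (π z, (e z).2) = e z := Prod.ext (e.coe_fst hz).symm rfl
    simp only [s, h]
    exact e.left_inv hz
  have hsd : MDifferentiableAt 𝓘(ℝ, HB) 𝓘(ℝ, HE) s (π z) := by
    have h1 : ContMDiffOn 𝓘(ℝ, HB) (𝓘(ℝ, HB).prod 𝓘(ℝ, HF)) ∞
        (fun b : B ↦ (b, (e z).2)) e.baseSet :=
      (contMDiff_id.prodMk contMDiff_const).contMDiffOn
    have h2 := hs.comp h1 (fun b hb ↦ e.mem_target.2 hb)
    exact (h2.contMDiffAt (e.open_baseSet.mem_nhds he)).mdifferentiableAt (by simp)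
  have hpd : MDifferentiableAt 𝓘(ℝ, HE) 𝓘(ℝ, HB) π (s (π z)) :=
    hπ.1.contMDiffAt.mdifferentiableAt (by simp)
  have hps : π ∘ s =ᶠ[𝓝 (π z)] id := by
    filter_upwards [e.open_baseSet.mem_nhds he] with b hb
    exact e.proj_symm_apply (e.mem_target.2 hb)
  have hc := (hpd.hasMFDerivAt.comp (π z) hsd.hasMFDerivAt).congr_of_eventuallyEq hps.symm
  have hu := hasMFDerivAt_unique hc (hasMFDerivAt_id (π z))
  have key : ∀ z', z' = z → (∃ A : HB → HE, ∀ v : HB, tangentMap HE HB π z' (A v) = v) →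
      Function.Surjective (tangentMap HE HB π z) := by
    rintro _ rfl ⟨A, hA⟩ v
    exact ⟨A v, hA v⟩
  exact key _ hsz ⟨fun v ↦ mfderiv 𝓘(ℝ, HB) 𝓘(ℝ, HE) s (π z) v, fun v ↦ congrArg (fun A ↦ A v) hu⟩

end Bundles

/-! ### Horizontal lifts -/

/-- The solution `h` of a smooth linear system `A h = b`, `Γ h = 0` is differentiable, if `A` is
surjective at the point and `Γ` restricts to the identity on the kernel of `A`. -/
lemma differentiableAt_of_apply_eq {H G : Type*} [NormedAddCommGroup H] [NormedSpace ℝ H]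
    [NormedAddCommGroup G] [NormedSpace ℝ G] [FiniteDimensional ℝ G]
    {A : H → H →L[ℝ] G} {Γ : H → H →L[ℝ] H} {b : H → G} {h : H → H} {y₀ : H}
    (hA : DifferentiableAt ℝ A y₀) (hΓ : DifferentiableAt ℝ Γ y₀) (hb : DifferentiableAt ℝ b y₀)
    (hsurj : Function.Surjective (A y₀)) (hΓh : ∀ᶠ y in 𝓝 y₀, Γ y (h y) = 0)
    (hAh : ∀ᶠ y in 𝓝 y₀, A y (h y) = b y) (hker : ∀ᶠ y in 𝓝 y₀, ∀ v, A y v = 0 → Γ y v = v) :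
    DifferentiableAt ℝ h y₀ := by
  have : CompleteSpace G := FiniteDimensional.complete ℝ G
  obtain ⟨R, hR⟩ := (A y₀).exists_rightInverse_of_surjective (LinearMap.range_eq_top.2 hsurj)
  -- `R (A y ∘ R)⁻¹` is a right inverse of `A y`, for `y` near `y₀`.
  have hM : DifferentiableAt ℝ (fun y ↦ (A y).comp R) y₀ := hA.clm_comp (differentiableAt_const R)
  have hM0 : IsUnit ((A y₀).comp R) := by rw [hR]; exact isUnit_one
  have hunit : ∀ᶠ y in 𝓝 y₀, IsUnit ((A y).comp R) :=
    hM.continuousAt.eventually_mem (Units.isOpen.mem_nhds hM0)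
  have hinv : DifferentiableAt ℝ (fun y ↦ Ring.inverse ((A y).comp R)) y₀ := by
    have h1 : DifferentiableAt ℝ Ring.inverse ((A y₀).comp R) := differentiableAt_inverse hM0
    exact DifferentiableAt.comp (f := fun y ↦ (A y).comp R) y₀ h1 hM
  have hk : DifferentiableAt ℝ (fun y ↦ R (Ring.inverse ((A y).comp R) (b y))) y₀ :=
    R.differentiableAt.comp y₀ (hinv.clm_apply hb)
  refine (hk.sub (hΓ.clm_apply hk)).congr_of_eventuallyEq ?_
  filter_upwards [hΓh, hAh, hker, hunit] with y h1 h2 h3 h4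
  have h5 : A y (R (Ring.inverse ((A y).comp R) (b y))) = b y :=
    congrArg (fun T ↦ T (b y)) (Ring.mul_inverse_cancel _ h4)
  have h6 := h3 (h y - R (Ring.inverse ((A y).comp R) (b y))) (by rw [map_sub, h2, h5, sub_self])
  rw [map_sub, h1, zero_sub] at h6
  simp only [Pi.sub_apply]
  rw [sub_eq_add_neg, h6]
  abel

section Bundles

variable {HE : Type*} [NormedAddCommGroup HE] [NormedSpace ℝ HE]
  {HB : Type*} [NormedAddCommGroup HB] [NormedSpace ℝ HB]
  {E : Type*} [TopologicalSpace E] [ChartedSpace HE E] [IsManifold 𝓘(ℝ, HE) ∞ E]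
  {B : Type*} [TopologicalSpace B] [ChartedSpace HB B]
  {π : E → B}

section Pointwise

variable (Γ : EhresmannConnection HE HB π) (X : (b : B) → TangentSpace 𝓘(ℝ, HB) b) (z : E)

lemma EhresmannConnection.toFun_horLift : Γ.toFun z (Γ.horLift X z) = 0 := by
  simp only [EhresmannConnection.horLift, map_sub, Γ.idem, sub_self]

variable {z} (hsurj : Function.Surjective (tangentMap HE HB π z))
include hsurj

lemma EhresmannConnection.tangentMap_horLift :
    tangentMap HE HB π z (Γ.horLift X z) = X (π z) := by
  simp only [EhresmannConnection.horLift, map_sub, Γ.tangentMap_toFun, sub_zero]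
  exact Function.rightInverse_invFun hsurj (X (π z))

lemma EhresmannConnection.horLift_eq {u : TangentSpace 𝓘(ℝ, HE) z} (hu : Γ.toFun z u = 0)
    (hX : X (π z) = tangentMap HE HB π z u) : Γ.horLift X z = u := by
  have h := (Γ.toFun_eq_self_iff z (Γ.horLift X z - u)).2
    (by rw [map_sub, Γ.tangentMap_horLift X hsurj, hX, sub_self])
  rw [map_sub, Γ.toFun_horLift, hu, sub_self] at h
  exact sub_eq_zero.1 h.symm

end Pointwise

variable [IsManifold 𝓘(ℝ, HB) ∞ B] (D : GeometricData HE HB π)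
  (X Y : (b : B) → TangentSpace 𝓘(ℝ, HB) b) (x : E)

omit [IsManifold 𝓘(ℝ, HB) ∞ B] in
lemma EhresmannConnection.eventually_endoInChart_horLift (Γ : EhresmannConnection HE HB π) :
    ∀ᶠ y in 𝓝 (extChartAt 𝓘(ℝ, HE) x x),
      endoInChart Γ.toFun x y (vectorInChart (Γ.horLift X) x y) = 0 := by
  filter_upwards [eventually_mem_source x] with y hy
  rw [vectorInChart, endoInChart_apply _ hy, Γ.toFun_horLift, map_zero]

lemma EhresmannConnection.eventually_fderiv_projInChart_horLift (Γ : EhresmannConnection HE HB π)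
    (hπ : ContMDiff 𝓘(ℝ, HE) 𝓘(ℝ, HB) ∞ π)
    (hsurj : ∀ z, Function.Surjective (tangentMap HE HB π z)) :
    ∀ᶠ y in 𝓝 (extChartAt 𝓘(ℝ, HE) x x),
      fderiv ℝ (projInChart HE HB π x) y (vectorInChart (Γ.horLift X) x y) =
        vectorInChart X (π x) (projInChart HE HB π x y) := by
  have h0 : ContinuousAt (fun y ↦ π ((extChartAt 𝓘(ℝ, HE) x).symm y))
      (extChartAt 𝓘(ℝ, HE) x x) :=
    hπ.continuous.continuousAt.comp (continuousAt_extChartAt_symm x)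
  have h1 := h0.preimage_mem_nhds (t := (extChartAt 𝓘(ℝ, HB) (π x)).source) (by
    rw [extChartAt_to_inv]; exact extChartAt_source_mem_nhds (π x))
  filter_upwards [eventually_fderiv_projInChart hπ x, h1] with y h hy
  rw [vectorInChart, h, Γ.tangentMap_horLift X (hsurj _), vectorInChart, projInChart,
    (extChartAt 𝓘(ℝ, HB) (π x)).left_inv hy]

omit [IsManifold 𝓘(ℝ, HE) ∞ E] [IsManifold 𝓘(ℝ, HB) ∞ B] in
lemma projInChart_self :
    projInChart HE HB π x (extChartAt 𝓘(ℝ, HE) x x) = extChartAt 𝓘(ℝ, HB) (π x) (π x) := by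
  rw [projInChart, extChartAt_to_inv]

variable {X Y}

lemma hasFDerivAt_vectorInChart_comp_projInChart (hπ : ContMDiff 𝓘(ℝ, HE) 𝓘(ℝ, HB) ∞ π)
    (hX : IsSmoothVectorField X) :
    HasFDerivAt (fun y ↦ vectorInChart X (π x) (projInChart HE HB π x y))
      ((fderiv ℝ (vectorInChart X (π x)) (extChartAt 𝓘(ℝ, HB) (π x) (π x))).comp
        (fderiv ℝ (projInChart HE HB π x) (extChartAt 𝓘(ℝ, HE) x x)))
      (extChartAt 𝓘(ℝ, HE) x x) := by
  refine HasFDerivAt.comp (g := vectorInChart X (π x)) (f := projInChart HE HB π x) _ ?_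
    ((contDiffAt_projInChart hπ x).differentiableAt (by simp)).hasFDerivAt
  rw [projInChart_self]
  exact ((contDiffAt_vectorInChart hX.contMDiffAt).differentiableAt (by simp)).hasFDerivAt

variable [FiniteDimensional ℝ HB]

lemma EhresmannConnection.differentiableAt_horLift (Γ : EhresmannConnection HE HB π)
    (hker : ∀ᶠ y in 𝓝 (extChartAt 𝓘(ℝ, HE) x x), ∀ v,
      fderiv ℝ (projInChart HE HB π x) y v = 0 → endoInChart Γ.toFun x y v = v)
    (hπ : ContMDiff 𝓘(ℝ, HE) 𝓘(ℝ, HB) ∞ π)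
    (hsurj : ∀ z, Function.Surjective (tangentMap HE HB π z)) (hX : IsSmoothVectorField X) :
    DifferentiableAt ℝ (vectorInChart (Γ.horLift X) x) (extChartAt 𝓘(ℝ, HE) x x) := by
  refine differentiableAt_of_apply_eq (differentiableAt_fderiv_projInChart hπ x)
    ((contDiffAt_endoInChart Γ.smooth x).differentiableAt (by simp))
    (hasFDerivAt_vectorInChart_comp_projInChart x hπ hX).differentiableAt ?_
    (Γ.eventually_endoInChart_horLift X x)
    (Γ.eventually_fderiv_projInChart_horLift X x hπ hsurj) hker
  intro w
  have h := (eventually_fderiv_projInChart hπ x).self_of_nhds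
  rw [extChartAt_to_inv] at h
  obtain ⟨v, hv⟩ := hsurj x (chartDerivInv (π x) (π x) w)
  exact ⟨chartDeriv x x v, by
    rw [h, hv, chartDeriv_chartDerivInv (mem_extChartAt_source (π x))]⟩

/-- The horizontal lift of a smooth vector field, read in a chart, is a horizontal lift in the
sense of jets. -/
lemma GeometricData.isHorizontalLift (hπ : ContMDiff 𝓘(ℝ, HE) 𝓘(ℝ, HB) ∞ π)
    (hsurj : ∀ z, Function.Surjective (tangentMap HE HB π z)) (hX : IsSmoothVectorField X) :
    (D.jet hπ x).IsHorizontalLift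
      (vectorInChart (D.Γ.horLift X) x (extChartAt 𝓘(ℝ, HE) x x))
      (fderiv ℝ (vectorInChart (D.Γ.horLift X) x) (extChartAt 𝓘(ℝ, HE) x x)) := by
  have hd := D.Γ.differentiableAt_horLift x (D.endoInChart_eq_self_of_fderiv hπ x) hπ hsurj hX
  refine ⟨(D.Γ.eventually_endoInChart_horLift X x).self_of_nhds, fun w ↦ ?_, fun w hw ↦ ?_⟩
  · refine (fderiv_apply_add_apply_fderiv (D.Γ.eventually_endoInChart_horLift X x)
      ((contDiffAt_endoInChart D.Γ.smooth x).differentiableAt (by simp)) hd w).trans ?_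
    simp
  -- For vertical `w`, differentiating `Tπ (horLift X) = X ∘ π` and `Tπ ∘ Γ = 0` shows that
  -- `D_w (horLift X) - dΓ (horLift X) w` is vertical.
  · have hw' : fderiv ℝ (projInChart HE HB π x) (extChartAt 𝓘(ℝ, HE) x x) w = 0 := by
      have h := (D.eventually_fderiv_projInChart_Γ hπ x).self_of_nhds w
      rwa [show endoInChart D.Γ.toFun x (extChartAt 𝓘(ℝ, HE) x x) w = w from hw] at h
    have h1 := fderiv_apply_add_apply_fderiv
      (D.Γ.eventually_fderiv_projInChart_horLift X x hπ hsurj)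
      (differentiableAt_fderiv_projInChart hπ x) hd w
    rw [(hasFDerivAt_vectorInChart_comp_projInChart x hπ hX).fderiv,
      ContinuousLinearMap.comp_apply, hw', map_zero] at h1
    have h2 := D.sndFDeriv_projInChart_Γ hπ x
      (vectorInChart (D.Γ.horLift X) x (extChartAt 𝓘(ℝ, HE) x x)) w
    rw [show endoInChart D.Γ.toFun x (extChartAt 𝓘(ℝ, HE) x x) w = w from hw,
      isSymmSndFDerivAt_projInChart hπ x _ w] at h2
    have h3 := (D.endoInChart_eq_self_of_fderiv hπ x).self_of_nhds
      (fderiv ℝ (vectorInChart (D.Γ.horLift X) x) (extChartAt 𝓘(ℝ, HE) x x) w -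
        (D.jet hπ x).dΓ (vectorInChart (D.Γ.horLift X) x (extChartAt 𝓘(ℝ, HE) x x)) w)
      (by rw [map_sub, sub_eq_zero]; exact add_left_cancel (h1.trans h2.symm))
    change (D.jet hπ x).Γ _ = _ at h3
    rw [map_sub, (D.jet hπ x).Γ_dΓ_of_vert _ hw, sub_zero] at h3
    rw [h3, sub_sub_cancel]

/-- The curvature is the vertical part of the bracket of the horizontal lifts, whose projection to
the base is `[X, Y]`. -/
lemma GeometricData.chartDeriv_curvature (hπ : ContMDiff 𝓘(ℝ, HE) 𝓘(ℝ, HB) ∞ π)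
    (hsurj : ∀ z, Function.Surjective (tangentMap HE HB π z)) (hX : IsSmoothVectorField X)
    (hY : IsSmoothVectorField Y) :
    chartDeriv x x (D.Γ.curvature X Y x) =
      (D.jet hπ x).Γ (fderiv ℝ (vectorInChart (D.Γ.horLift Y) x) (extChartAt 𝓘(ℝ, HE) x x)
          (vectorInChart (D.Γ.horLift X) x (extChartAt 𝓘(ℝ, HE) x x)) -
        fderiv ℝ (vectorInChart (D.Γ.horLift X) x) (extChartAt 𝓘(ℝ, HE) x x)
          (vectorInChart (D.Γ.horLift Y) x (extChartAt 𝓘(ℝ, HE) x x))) := by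
  have key : ∀ {Z : (b : B) → TangentSpace 𝓘(ℝ, HB) b}, IsSmoothVectorField Z → ∀ w,
      fderiv ℝ (fderiv ℝ (projInChart HE HB π x)) (extChartAt 𝓘(ℝ, HE) x x) w
          (vectorInChart (D.Γ.horLift Z) x (extChartAt 𝓘(ℝ, HE) x x)) +
        fderiv ℝ (projInChart HE HB π x) (extChartAt 𝓘(ℝ, HE) x x)
          (fderiv ℝ (vectorInChart (D.Γ.horLift Z) x) (extChartAt 𝓘(ℝ, HE) x x) w) =
      fderiv ℝ (vectorInChart Z (π x)) (extChartAt 𝓘(ℝ, HB) (π x) (π x))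
        (fderiv ℝ (projInChart HE HB π x) (extChartAt 𝓘(ℝ, HE) x x) w) := by
    intro Z hZ w
    rw [fderiv_apply_add_apply_fderiv
      (D.Γ.eventually_fderiv_projInChart_horLift Z x hπ hsurj)
      (differentiableAt_fderiv_projInChart hπ x)
      (D.Γ.differentiableAt_horLift x (D.endoInChart_eq_self_of_fderiv hπ x) hπ hsurj hZ) w,
      (hasFDerivAt_vectorInChart_comp_projInChart x hπ hZ).fderiv]
    rfl
  have lift : ∀ Z : (b : B) → TangentSpace 𝓘(ℝ, HB) b,
      fderiv ℝ (projInChart HE HB π x) (extChartAt 𝓘(ℝ, HE) x x)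
        (vectorInChart (D.Γ.horLift Z) x (extChartAt 𝓘(ℝ, HE) x x)) =
      vectorInChart Z (π x) (extChartAt 𝓘(ℝ, HB) (π x) (π x)) := fun Z ↦ by
    rw [(D.Γ.eventually_fderiv_projInChart_horLift Z x hπ hsurj).self_of_nhds, projInChart_self]
  have hbr := chartDeriv_mlieBracket (D.Γ.horLift X) (D.Γ.horLift Y) x
  have hlift := lift (VectorField.mlieBracket 𝓘(ℝ, HB) X Y)
  have hΓ := (D.Γ.eventually_endoInChart_horLift
    (VectorField.mlieBracket 𝓘(ℝ, HB) X Y) x).self_of_nhds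
  rw [vectorInChart_self (VectorField.mlieBracket 𝓘(ℝ, HB) X Y), chartDeriv_mlieBracket,
    ← lift X, ← lift Y, ← key hX, ← key hY] at hlift
  rw [vectorInChart_self] at hlift hΓ
  have hvert := (D.endoInChart_eq_self_of_fderiv hπ x).self_of_nhds
    (chartDeriv x x (D.Γ.curvature X Y x)) (by
      rw [EhresmannConnection.curvature, map_sub, map_sub, hbr, hlift, map_sub,
        isSymmSndFDerivAt_projInChart hπ x]
      abel)
  rw [← hvert, EhresmannConnection.curvature, map_sub, map_sub, hbr, hΓ, sub_zero]
  rfl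

end Bundles

/-! ### Sections of the coupling bundle -/

section Bundles

variable {HE : Type*} [NormedAddCommGroup HE] [NormedSpace ℝ HE]
  {HB : Type*} [NormedAddCommGroup HB] [NormedSpace ℝ HB]
  {E : Type*} [TopologicalSpace E] [ChartedSpace HE E] [IsManifold 𝓘(ℝ, HE) ∞ E]
  {B : Type*} [TopologicalSpace B] [ChartedSpace HB B]
  {π : E → B} (D : GeometricData HE HB π)

/-- The pull-back of a smooth 1-form by a smooth field of endomorphisms is smooth. -/
lemma IsSmoothOneForm.comp {ξ : (x : E) → Cotangent HE x} (hξ : IsSmoothOneForm ξ)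
    {A : (x : E) → TangentSpace 𝓘(ℝ, HE) x →L[ℝ] TangentSpace 𝓘(ℝ, HE) x}
    (hA : ContMDiff 𝓘(ℝ, HE) (𝓘(ℝ, HE).prod 𝓘(ℝ, HE →L[ℝ] HE)) ∞
      (fun x ↦ Bundle.TotalSpace.mk' (HE →L[ℝ] HE)
      (E := fun x : E ↦ TangentSpace 𝓘(ℝ, HE) x →L[ℝ] TangentSpace 𝓘(ℝ, HE) x) x (A x))) :
    IsSmoothOneForm fun x ↦ (ξ x).comp (A x) := by
  intro x
  have h1 := ((contMDiffAt_hom_bundle _).1 (hξ x)).2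
  have h2 := ((contMDiffAt_hom_bundle _).1 (hA x)).2
  refine (contMDiffAt_hom_bundle _).2 ⟨contMDiffAt_id,
    (h1.clm_comp h2).congr_of_eventuallyEq ?_⟩
  filter_upwards [extChartAt_source_mem_nhds (I := 𝓘(ℝ, HE)) x] with z hz
  ext v
  simp only [ContinuousLinearMap.inCoordinates, ContinuousLinearMap.comp_apply,
    continuousLinearMapAt_eq_chartDeriv hz, symmL_eq_chartDerivInv hz, chartDerivInv_chartDeriv hz]

/-- Every vector of the coupling bundle extends to a smooth section, the image of an arbitrary
smooth section of `TE ⊕ T*E` under the projection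
`(u, α) ↦ (u - Γ u + V α, F u + α ∘ Γ)` onto the coupling bundle. -/
lemma GeometricData.exists_section [FiniteDimensional ℝ HE] [T2Space E] {x : E}
    {v : TangentSpace 𝓘(ℝ, HE) x} {α : Cotangent HE x} (h : (v, α) ∈ D.couplingBundle x) :
    ∃ (X : (x : E) → TangentSpace 𝓘(ℝ, HE) x) (ξ : (x : E) → Cotangent HE x),
      IsSmoothVectorField X ∧ IsSmoothOneForm ξ ∧ (∀ x, (X x, ξ x) ∈ D.couplingBundle x) ∧
      X x = v ∧ ξ x = α := by
  obtain ⟨X, rfl, hX⟩ := exists_contMDiff_section (H := HE) (F := HE)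
    (fun x : E ↦ TangentSpace 𝓘(ℝ, HE) x) v
  obtain ⟨ξ, rfl, hξ⟩ := exists_contMDiff_section (H := HE) (F := HE →L[ℝ] ℝ)
    (fun x : E ↦ Cotangent HE x) α
  refine ⟨fun z ↦ X z - D.Γ.toFun z (X z) + D.V.sharp z (ξ z),
    fun z ↦ D.Fbar.toFun z (X z) + (ξ z).comp (D.Γ.toFun z), ?_, ?_, fun z ↦ ?_, ?_, ?_⟩
  · exact (hX.sub_section (D.Γ.smooth.clm_bundle_apply hX)).add_section
      (D.V.smooth.clm_bundle_apply hξ)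
  · exact (D.Fbar.smooth.clm_bundle_apply hX).add_section (IsSmoothOneForm.comp hξ D.Γ.smooth)
  · rw [D.mem_couplingBundle_iff]
    refine ⟨?_, fun w ↦ ?_⟩
    · simp only [map_add, map_sub, D.Γ.idem, D.toFun_sharp, D.sharp_Fbar, D.sharp_comp_toFun,
        sub_self]
    · have h1 : D.Fbar.toFun z (X z) (D.Γ.toFun z w) = 0 := by
        rw [D.Fbar.skew, D.Fbar_toFun]; simp
      simp only [map_add, map_sub, add_apply, ContinuousLinearMap.comp_apply, D.Γ.idem, h1,
        D.Fbar_toFun, D.Fbar_sharp]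
      simp
  · obtain ⟨h1, h2⟩ := (D.mem_couplingBundle_iff _ _ _).1 h
    simp only [h1, sub_add_cancel]
  · obtain ⟨h1, h2⟩ := (D.mem_couplingBundle_iff _ _ _).1 h
    ext w
    rw [add_apply, ContinuousLinearMap.comp_apply, ← h2 w, sub_add_cancel]

variable [IsManifold 𝓘(ℝ, HB) ∞ B] (hπ : ContMDiff 𝓘(ℝ, HE) 𝓘(ℝ, HB) ∞ π)

lemma GeometricData.jet_Γ_chartDeriv (x : E) (v : TangentSpace 𝓘(ℝ, HE) x) :
    (D.jet hπ x).Γ (chartDeriv x x v) = chartDeriv x x (D.Γ.toFun x v) :=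
  endoInChart_self D.Γ.toFun x v

lemma GeometricData.jet_V_comp (x : E) (α : Cotangent HE x) :
    (D.jet hπ x).V (α.comp (chartDerivInv x x)) = chartDeriv x x (D.V.sharp x α) :=
  D.V.inChart_self x α

lemma GeometricData.jet_F_chartDeriv (x : E) (u v : TangentSpace 𝓘(ℝ, HE) x) :
    (D.jet hπ x).F (chartDeriv x x u) (chartDeriv x x v) = D.Fbar.toFun x u v :=
  D.Fbar.inChart_self x u v

lemma GeometricData.jet_mem_iff (x : E) (X : TangentSpace 𝓘(ℝ, HE) x) (ξ : Cotangent HE x) :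
    (D.jet hπ x).Mem (chartDeriv x x X) (ξ.comp (chartDerivInv x x)) ↔
      (X, ξ) ∈ D.couplingBundle x := by
  have hx := mem_extChartAt_source (I := 𝓘(ℝ, HE)) x
  rw [D.mem_couplingBundle_iff, GeometricJet.Mem, D.jet_Γ_chartDeriv, D.jet_V_comp,
    (chartDeriv_injective hx).eq_iff]
  refine and_congr Iff.rfl ⟨fun h v ↦ ?_, fun h w ↦ ?_⟩
  · have h' := h (chartDeriv x x v)
    rwa [D.jet_Γ_chartDeriv, comp_chartDerivInv_apply, comp_chartDerivInv_apply,
      D.jet_F_chartDeriv] at h'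
  · obtain ⟨v, rfl⟩ := chartDeriv_surjective hx w
    rw [D.jet_Γ_chartDeriv, comp_chartDerivInv_apply, comp_chartDerivInv_apply,
      D.jet_F_chartDeriv, h]

section Section

variable {D} {X : (x : E) → TangentSpace 𝓘(ℝ, HE) x} {ξ : (x : E) → Cotangent HE x}
  (hL : ∀ x, (X x, ξ x) ∈ D.couplingBundle x) (x : E)
  (hX : DifferentiableAt ℝ (vectorInChart X x) (extChartAt 𝓘(ℝ, HE) x x))
  (hξ : DifferentiableAt ℝ (oneFormInChart ξ x) (extChartAt 𝓘(ℝ, HE) x x))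
include hL hX hξ

/-- The derivative of the first equation of the coupling bundle along a section. -/
lemma GeometricData.fderiv_section_vector (w : HE) :
    (D.jet hπ x).dΓ w (vectorInChart X x (extChartAt 𝓘(ℝ, HE) x x)) +
        (D.jet hπ x).Γ (fderiv ℝ (vectorInChart X x) (extChartAt 𝓘(ℝ, HE) x x) w) =
      (D.jet hπ x).dV w (oneFormInChart ξ x (extChartAt 𝓘(ℝ, HE) x x)) +
        (D.jet hπ x).V (fderiv ℝ (oneFormInChart ξ x) (extChartAt 𝓘(ℝ, HE) x x) w) := by
  have h : ∀ᶠ y in 𝓝 (extChartAt 𝓘(ℝ, HE) x x),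
      endoInChart D.Γ.toFun x y (vectorInChart X x y) =
        D.V.inChart x y (oneFormInChart ξ x y) := by
    filter_upwards [eventually_mem_source x] with y hy
    rw [vectorInChart, endoInChart_apply _ hy, D.V.inChart_oneFormInChart ξ hy,
      ((D.mem_couplingBundle_iff _ _ _).1 (hL _)).1]
  refine (fderiv_apply_add_apply_fderiv h
    ((contDiffAt_endoInChart D.Γ.smooth x).differentiableAt (by simp)) hX w).trans ?_
  exact fderiv_clm_apply_apply ((D.V.contDiffAt_inChart x).differentiableAt (by simp)) hξ w

/-- The derivative of the second equation of the coupling bundle along a section. -/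
lemma GeometricData.fderiv_section_oneForm (w v : HE) :
    fderiv ℝ (oneFormInChart ξ x) (extChartAt 𝓘(ℝ, HE) x x) w v -
        fderiv ℝ (oneFormInChart ξ x) (extChartAt 𝓘(ℝ, HE) x x) w ((D.jet hπ x).Γ v) -
        oneFormInChart ξ x (extChartAt 𝓘(ℝ, HE) x x) ((D.jet hπ x).dΓ w v) =
      (D.jet hπ x).dF w (vectorInChart X x (extChartAt 𝓘(ℝ, HE) x x)) v +
        (D.jet hπ x).F (fderiv ℝ (vectorInChart X x) (extChartAt 𝓘(ℝ, HE) x x) w) v := by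
  have hΓ := (contDiffAt_endoInChart D.Γ.smooth x).differentiableAt (by simp)
  have hF := (D.Fbar.contDiffAt_inChart x).differentiableAt (by simp)
  have h : ∀ᶠ y in 𝓝 (extChartAt 𝓘(ℝ, HE) x x),
      oneFormInChart ξ x y (v - endoInChart D.Γ.toFun x y v) =
        D.Fbar.inChart x y (vectorInChart X x y) v := by
    filter_upwards [eventually_mem_source x] with y hy
    obtain ⟨v, rfl⟩ := chartDeriv_surjective hy v
    rw [vectorInChart, endoInChart_apply _ hy, map_sub, oneFormInChart_apply _ hy,
      oneFormInChart_apply _ hy, D.Fbar.inChart_apply hy,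
      ((D.mem_couplingBundle_iff _ _ _).1 (hL _)).2]
  have hv := hΓ.clm_apply (differentiableAt_const v)
  have h' := fderiv_apply_add_apply_fderiv h hξ ((differentiableAt_const v).sub hv) w
  rw [fderiv_clm_apply_const (hF.clm_apply hX), fderiv_clm_apply_apply hF hX,
    fderiv_const_sub, neg_apply, fderiv_clm_apply_const hΓ, map_sub, map_neg,
    ← sub_eq_add_neg] at h'
  exact h'

end Section

/-- The Courant bracket of two sections of the coupling bundle, paired with a vector of the
coupling bundle, depends only on the values of the sections. -/
lemma GeometricData.pairing_courantBracket {X Y : (x : E) → TangentSpace 𝓘(ℝ, HE) x}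
    {ξ η : (x : E) → Cotangent HE x}
    (hX : IsSmoothVectorField X) (hξ : IsSmoothOneForm ξ)
    (hXL : ∀ x, (X x, ξ x) ∈ D.couplingBundle x)
    (hY : IsSmoothVectorField Y) (hη : IsSmoothOneForm η)
    (hYL : ∀ x, (Y x, η x) ∈ D.couplingBundle x) (x : E)
    {Z : TangentSpace 𝓘(ℝ, HE) x} {ζ : Cotangent HE x} (hZ : (Z, ζ) ∈ D.couplingBundle x) :
    ζ (courantBracket X ξ Y η x).1 + (courantBracket X ξ Y η x).2 Z =
      (D.jet hπ x).courantTensor (chartDeriv x x (X x)) ((ξ x).comp (chartDerivInv x x))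
        (chartDeriv x x (Y x)) ((η x).comp (chartDerivInv x x))
        (chartDeriv x x Z) (ζ.comp (chartDerivInv x x)) := by
  have hdX := (contDiffAt_vectorInChart (x₀ := x) hX.contMDiffAt).differentiableAt (by simp)
  have hdY := (contDiffAt_vectorInChart (x₀ := x) hY.contMDiffAt).differentiableAt (by simp)
  have hdξ := (contDiffAt_oneFormInChart hξ x).differentiableAt (by simp)
  have hdη := (contDiffAt_oneFormInChart hη x).differentiableAt (by simp)
  have hmY := (D.jet_mem_iff hπ x _ _).2 (hYL x)
  rw [← vectorInChart_self, ← oneFormInChart_self] at hmY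
  have key := (D.jet hπ x).pairing_bracket hmY
    (fderiv_section_vector hπ hXL x hdX hdξ) (fderiv_section_oneForm hπ hXL x hdX hdξ)
    (fderiv_section_vector hπ hYL x hdY hdη) (fderiv_section_oneForm hπ hYL x hdY hdη)
    ((D.jet_mem_iff hπ x _ _).2 hZ)
  rw [← chartDeriv_mlieBracket, comp_chartDerivInv_apply] at key
  rw [← vectorInChart_self, ← vectorInChart_self, ← oneFormInChart_self, ← oneFormInChart_self,
    ← key]
  simp only [courantBracket]
  rw [sub_apply, lieDerivOneForm_apply hdX hdη, extDerivOne_apply, ← vectorInChart_self Y]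

/-- The coupling bundle is closed under the Courant bracket if and only if its Courant tensor
vanishes at every point. -/
lemma GeometricData.isCourantClosed_iff [FiniteDimensional ℝ HE] [T2Space E] :
    IsCourantClosed D.couplingBundle ↔ ∀ x X ξ Y η Z ζ, (D.jet hπ x).Mem X ξ →
      (D.jet hπ x).Mem Y η → (D.jet hπ x).Mem Z ζ →
      (D.jet hπ x).courantTensor X ξ Y η Z ζ = 0 := by
  have pull : ∀ (x : E) (w : HE) (a : HE →L[ℝ] ℝ),
      ∃ (v : TangentSpace 𝓘(ℝ, HE) x) (α : Cotangent HE x),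
        chartDeriv x x v = w ∧ α.comp (chartDerivInv x x) = a := by
    intro x w a
    obtain ⟨v, hv⟩ := chartDeriv_surjective (mem_extChartAt_source x) w
    obtain ⟨α, hα⟩ := exists_comp_chartDerivInv_eq x a
    exact ⟨v, α, hv, hα⟩
  constructor
  · intro h x X₀ ξ₀ Y₀ η₀ Z₀ ζ₀ hX hY hZ
    obtain ⟨X, ξ, rfl, rfl⟩ := pull x X₀ ξ₀
    obtain ⟨Y, η, rfl, rfl⟩ := pull x Y₀ η₀
    obtain ⟨Z, ζ, rfl, rfl⟩ := pull x Z₀ ζ₀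
    rw [D.jet_mem_iff] at hX hY hZ
    obtain ⟨X, ξ, hXs, hξs, hXL, rfl, rfl⟩ := D.exists_section hX
    obtain ⟨Y, η, hYs, hηs, hYL, rfl, rfl⟩ := D.exists_section hY
    rw [← D.pairing_courantBracket hπ hXs hξs hXL hYs hηs hYL x hZ]
    -- The coupling bundle is isotropic.
    have h1 := (D.jet_mem_iff hπ x _ _).2 (h X ξ Y η hXs hξs hXL hYs hηs hYL x)
    have h2 := (D.jet_mem_iff hπ x _ _).2 hZ
    have h3 := (D.jet hπ x).pairing_eq_zero h1 h2
    rwa [comp_chartDerivInv_apply, comp_chartDerivInv_apply] at h3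
  · intro h X ξ Y η hXs hξs hXL hYs hηs hYL x
    rw [← Prod.mk.eta (p := courantBracket X ξ Y η x), ← D.jet_mem_iff hπ]
    refine GeometricJet.mem_of_forall_pairing _ fun Z₀ ζ₀ hZ ↦ ?_
    obtain ⟨Z, ζ, rfl, rfl⟩ := pull x Z₀ ζ₀
    rw [comp_chartDerivInv_apply, comp_chartDerivInv_apply, D.pairing_courantBracket hπ hXs hξs
      hXL hYs hηs hYL x ((D.jet_mem_iff hπ x _ _).1 hZ)]
    exact h x _ _ _ _ _ _ ((D.jet_mem_iff hπ x _ _).2 (hXL x))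
      ((D.jet_mem_iff hπ x _ _).2 (hYL x)) hZ

end Bundles

/-! ### The integrability conditions as components of the Courant tensor -/

section Bundles

variable {HE : Type*} [NormedAddCommGroup HE] [NormedSpace ℝ HE]
  {HB : Type*} [NormedAddCommGroup HB] [NormedSpace ℝ HB]
  {E : Type*} [TopologicalSpace E] [ChartedSpace HE E] [IsManifold 𝓘(ℝ, HE) ∞ E]
  {B : Type*} [TopologicalSpace B] [ChartedSpace HB B] [IsManifold 𝓘(ℝ, HB) ∞ B]
  {π : E → B} (D : GeometricData HE HB π) (hπ : ContMDiff 𝓘(ℝ, HE) 𝓘(ℝ, HB) ∞ π)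

lemma GeometricData.schoutenBracket_eq (x : E) (α β γ : Cotangent HE x) :
    schoutenBracket D.V D.V x α β γ =
      2 * (D.jet hπ x).jacobiator (α.comp (chartDerivInv x x)) (β.comp (chartDerivInv x x))
        (γ.comp (chartDerivInv x x)) := by
  simp only [schoutenBracket, GeometricJet.jacobiator, GeometricData.jet]
  ring

lemma GeometricData.poisson_iff :
    (∀ (x : E) (α β γ : Cotangent HE x), schoutenBracket D.V D.V x α β γ = 0) ↔
      ∀ (x : E) (α β γ : HE →L[ℝ] ℝ), (D.jet hπ x).courantTensor
        ((D.jet hπ x).V (α.comp (D.jet hπ x).Γ)) (α.comp (D.jet hπ x).Γ)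
        ((D.jet hπ x).V (β.comp (D.jet hπ x).Γ)) (β.comp (D.jet hπ x).Γ)
        ((D.jet hπ x).V (γ.comp (D.jet hπ x).Γ)) (γ.comp (D.jet hπ x).Γ) = 0 := by
  simp only [GeometricJet.courantTensor_ann_eq_jacobiator]
  refine forall_congr' fun x ↦ ⟨fun h a b c ↦ ?_, fun h α β γ ↦ ?_⟩
  · obtain ⟨α, rfl⟩ := exists_comp_chartDerivInv_eq x a
    obtain ⟨β, rfl⟩ := exists_comp_chartDerivInv_eq x b
    obtain ⟨γ, rfl⟩ := exists_comp_chartDerivInv_eq x c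
    have h' := h α β γ
    rw [D.schoutenBracket_eq hπ] at h'
    linarith
  · rw [D.schoutenBracket_eq hπ, h, mul_zero]

lemma GeometricData.jet_Γ_eq_zero_iff (x : E) (u : TangentSpace 𝓘(ℝ, HE) x) :
    (D.jet hπ x).Γ (chartDeriv x x u) = 0 ↔ u ∈ D.Γ.hor x := by
  rw [D.jet_Γ_chartDeriv, map_eq_zero_iff _ (chartDeriv_injective (mem_extChartAt_source x))]
  rfl

lemma GeometricData.jet_Γ_horLift (X : (b : B) → TangentSpace 𝓘(ℝ, HB) b) (x : E) :
    (D.jet hπ x).Γ (chartDeriv x x (D.Γ.horLift X x)) = 0 :=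
  (D.jet_Γ_eq_zero_iff hπ x _).2 (D.Γ.toFun_horLift X x)

lemma GeometricData.closed_iff :
    (∀ (x : E), ∀ u ∈ D.Γ.hor x, ∀ v ∈ D.Γ.hor x, ∀ w ∈ D.Γ.hor x,
        D.Fbar.extDeriv x u v w = 0) ↔
      ∀ x u v w, (D.jet hπ x).Γ u = 0 → (D.jet hπ x).Γ v = 0 → (D.jet hπ x).Γ w = 0 →
        (D.jet hπ x).courantTensor u ((D.jet hπ x).F u) v ((D.jet hπ x).F v)
          w ((D.jet hπ x).F w) = 0 := by
  have key : ∀ (x : E), ∀ u ∈ D.Γ.hor x, ∀ v ∈ D.Γ.hor x, ∀ w ∈ D.Γ.hor x,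
      D.Fbar.extDeriv x u v w = (D.jet hπ x).courantTensor
        (chartDeriv x x u) ((D.jet hπ x).F (chartDeriv x x u))
        (chartDeriv x x v) ((D.jet hπ x).F (chartDeriv x x v))
        (chartDeriv x x w) ((D.jet hπ x).F (chartDeriv x x w)) := fun x u hu v hv w hw ↦
    ((D.jet hπ x).courantTensor_hor_hor_hor ((D.jet_Γ_eq_zero_iff hπ x u).2 hu)
      ((D.jet_Γ_eq_zero_iff hπ x v).2 hv) ((D.jet_Γ_eq_zero_iff hπ x w).2 hw)).symm
  refine forall_congr' fun x ↦ ⟨fun h u v w hu hv hw ↦ ?_, fun h u hu v hv w hw ↦ ?_⟩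
  · have hx := mem_extChartAt_source (I := 𝓘(ℝ, HE)) x
    obtain ⟨u, rfl⟩ := chartDeriv_surjective hx u
    obtain ⟨v, rfl⟩ := chartDeriv_surjective hx v
    obtain ⟨w, rfl⟩ := chartDeriv_surjective hx w
    rw [D.jet_Γ_eq_zero_iff] at hu hv hw
    rw [← key x u hu v hv w hw, h u hu v hv w hw]
  · rw [key x u hu v hv w hw]
    exact h _ _ _ ((D.jet_Γ_eq_zero_iff hπ x u).2 hu) ((D.jet_Γ_eq_zero_iff hπ x v).2 hv)
      ((D.jet_Γ_eq_zero_iff hπ x w).2 hw)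

variable (hsurj : ∀ z, Function.Surjective (tangentMap HE HB π z)) [FiniteDimensional ℝ HB]

section Lift

variable {X Y : (b : B) → TangentSpace 𝓘(ℝ, HB) b} {x : E}
include hsurj

/-- The Lie derivative of `V` along a horizontal lift is a component of the Courant tensor. -/
lemma GeometricData.lieDeriv_horLift (hX : IsSmoothVectorField X)
    {α β : (x : E) → Cotangent HE x} (hα : IsSmoothOneForm α) (hβ : IsSmoothOneForm β) :
    D.V.lieDeriv (D.Γ.horLift X) α β x = (D.jet hπ x).courantTensor
      (chartDeriv x x (D.Γ.horLift X x)) ((D.jet hπ x).F (chartDeriv x x (D.Γ.horLift X x)))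
      ((D.jet hπ x).V (((α x).comp (chartDerivInv x x)).comp (D.jet hπ x).Γ))
      (((α x).comp (chartDerivInv x x)).comp (D.jet hπ x).Γ)
      ((D.jet hπ x).V (((β x).comp (chartDerivInv x x)).comp (D.jet hπ x).Γ))
      (((β x).comp (chartDerivInv x x)).comp (D.jet hπ x).Γ) := by
  have h := (D.isHorizontalLift x hπ hsurj hX).courantTensor_eq_lieDeriv
    ((α x).comp (chartDerivInv x x)) ((β x).comp (chartDerivInv x x))
  rw [vectorInChart_self] at h
  rw [h, BivectorField.lieDeriv_eq _
    (D.Γ.differentiableAt_horLift x (D.endoInChart_eq_self_of_fderiv hπ x) hπ hsurj hX)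
    ((contDiffAt_oneFormInChart hα x).differentiableAt (by simp))
    ((contDiffAt_oneFormInChart hβ x).differentiableAt (by simp)), vectorInChart_self]
  rfl

/-- The difference of the two sides of the curvature condition is a component of the Courant
tensor. -/
lemma GeometricData.courantTensor_horLift (hX : IsSmoothVectorField X)
    (hY : IsSmoothVectorField Y) (α : HE →L[ℝ] ℝ) :
    (D.jet hπ x).courantTensor
      (chartDeriv x x (D.Γ.horLift X x)) ((D.jet hπ x).F (chartDeriv x x (D.Γ.horLift X x)))
      (chartDeriv x x (D.Γ.horLift Y x)) ((D.jet hπ x).F (chartDeriv x x (D.Γ.horLift Y x)))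
      ((D.jet hπ x).V (α.comp (D.jet hπ x).Γ)) (α.comp (D.jet hπ x).Γ) =
    α (chartDeriv x x (D.Γ.curvature X Y x - D.V.sharp x
      (differential (fun y ↦ D.Fbar.toFun y (D.Γ.horLift X y) (D.Γ.horLift Y y)) x))) := by
  have hdX := D.Γ.differentiableAt_horLift x (D.endoInChart_eq_self_of_fderiv hπ x) hπ hsurj hX
  have hdY := D.Γ.differentiableAt_horLift x (D.endoInChart_eq_self_of_fderiv hπ x) hπ hsurj hY
  have hdF := (D.Fbar.contDiffAt_inChart x).differentiableAt (n := ∞) (by simp)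
  have h : (fun y ↦ D.Fbar.toFun y (D.Γ.horLift X y) (D.Γ.horLift Y y)) ∘
      (extChartAt 𝓘(ℝ, HE) x).symm =ᶠ[𝓝 (extChartAt 𝓘(ℝ, HE) x x)]
      fun y ↦ D.Fbar.inChart x y (vectorInChart (D.Γ.horLift X) x y)
        (vectorInChart (D.Γ.horLift Y) x y) := by
    filter_upwards [eventually_mem_source x] with y hy
    exact (D.Fbar.inChart_apply hy _ _).symm
  have hd := ((hdF.clm_apply hdX).clm_apply hdY).congr_of_eventuallyEq h
  have key := (D.isHorizontalLift x hπ hsurj hX).courantTensor_eq_curvature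
    (D.isHorizontalLift x hπ hsurj hY)
    (δ := (differential (fun y ↦ D.Fbar.toFun y (D.Γ.horLift X y) (D.Γ.horLift Y y)) x).comp
      (chartDerivInv x x)) (fun w ↦ by
        rw [ContinuousLinearMap.comp_apply, differential_apply hd,
          chartDeriv_chartDerivInv (mem_extChartAt_source x), h.fderiv_eq,
          fderiv_clm_apply_apply (hdF.clm_apply hdX) hdY, fderiv_clm_apply_apply hdF hdX]
        rfl) α
  rw [← D.chartDeriv_curvature x hπ hsurj hX hY, vectorInChart_self, vectorInChart_self,
    D.jet_V_comp, ← map_sub] at key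
  exact key

end Lift

include hsurj

/-- Every horizontal vector is a value of the horizontal lift of a smooth vector field. -/
lemma GeometricData.exists_horLift_eq [T2Space B] {x : E} {u : HE}
    (hu : (D.jet hπ x).Γ u = 0) : ∃ X : (b : B) → TangentSpace 𝓘(ℝ, HB) b,
      IsSmoothVectorField X ∧ chartDeriv x x (D.Γ.horLift X x) = u := by
  obtain ⟨u, rfl⟩ := chartDeriv_surjective (mem_extChartAt_source x) u
  obtain ⟨X, hXx, hX⟩ := exists_contMDiff_section (H := HB) (F := HB)
    (fun b : B ↦ TangentSpace 𝓘(ℝ, HB) b) (tangentMap HE HB π x u)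
  exact ⟨X, hX, by
    rw [D.Γ.horLift_eq X (hsurj x) ((D.jet_Γ_eq_zero_iff hπ x u).1 hu) hXx]⟩

lemma GeometricData.preserves_iff [FiniteDimensional ℝ HE] [T2Space E] [T2Space B] :
    (∀ X : (b : B) → TangentSpace 𝓘(ℝ, HB) b, IsSmoothVectorField X →
      ∀ α β : (x : E) → Cotangent HE x, IsSmoothOneForm α → IsSmoothOneForm β →
      ∀ x, D.V.lieDeriv (D.Γ.horLift X) α β x = 0) ↔
    ∀ x u (α β : HE →L[ℝ] ℝ), (D.jet hπ x).Γ u = 0 →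
      (D.jet hπ x).courantTensor u ((D.jet hπ x).F u)
        ((D.jet hπ x).V (α.comp (D.jet hπ x).Γ)) (α.comp (D.jet hπ x).Γ)
        ((D.jet hπ x).V (β.comp (D.jet hπ x).Γ)) (β.comp (D.jet hπ x).Γ) = 0 := by
  constructor
  · intro h x u a b hu
    obtain ⟨X, hX, rfl⟩ := D.exists_horLift_eq hπ hsurj hu
    obtain ⟨α₀, rfl⟩ := exists_comp_chartDerivInv_eq x a
    obtain ⟨β₀, rfl⟩ := exists_comp_chartDerivInv_eq x b
    obtain ⟨α, rfl, hα⟩ := exists_contMDiff_section (H := HE) (F := HE →L[ℝ] ℝ)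
      (fun x : E ↦ Cotangent HE x) α₀
    obtain ⟨β, rfl, hβ⟩ := exists_contMDiff_section (H := HE) (F := HE →L[ℝ] ℝ)
      (fun x : E ↦ Cotangent HE x) β₀
    rw [← D.lieDeriv_horLift hπ hsurj hX hα hβ]
    exact h X hX α β hα hβ x
  · intro h X hX α β hα hβ x
    rw [D.lieDeriv_horLift hπ hsurj hX hα hβ]
    exact h x _ _ _ (D.jet_Γ_horLift hπ X x)

lemma GeometricData.curvature_eq_iff [T2Space B] :
    (∀ X Y : (b : B) → TangentSpace 𝓘(ℝ, HB) b,
      IsSmoothVectorField X → IsSmoothVectorField Y → ∀ x,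
      D.Γ.curvature X Y x = D.V.sharp x
        (differential (fun y ↦ D.Fbar.toFun y (D.Γ.horLift X y) (D.Γ.horLift Y y)) x)) ↔
    ∀ x u v (α : HE →L[ℝ] ℝ), (D.jet hπ x).Γ u = 0 → (D.jet hπ x).Γ v = 0 →
      (D.jet hπ x).courantTensor u ((D.jet hπ x).F u) v ((D.jet hπ x).F v)
        ((D.jet hπ x).V (α.comp (D.jet hπ x).Γ)) (α.comp (D.jet hπ x).Γ) = 0 := by
  constructor
  · intro h x u v α hu hv
    obtain ⟨X, hX, rfl⟩ := D.exists_horLift_eq hπ hsurj hu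
    obtain ⟨Y, hY, rfl⟩ := D.exists_horLift_eq hπ hsurj hv
    rw [D.courantTensor_horLift hπ hsurj hX hY, h X Y hX hY x, sub_self, map_zero, map_zero]
  · intro h X Y hX hY x
    refine sub_eq_zero.1 (chartDeriv_injective (mem_extChartAt_source x) ?_)
    rw [map_zero]
    refine (SeparatingDual.eq_zero_iff_forall_dual_eq_zero (R := ℝ) _).2 fun α ↦ ?_
    rw [← D.courantTensor_horLift hπ hsurj hX hY]
    exact h x _ _ α (D.jet_Γ_horLift hπ X x) (D.jet_Γ_horLift hπ Y x)

end Bundles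

end CouplingDirac

end

theorem theorem2p1
    {HE : Type*} [NormedAddCommGroup HE] [NormedSpace ℝ HE] [FiniteDimensional ℝ HE]
    {HB : Type*} [NormedAddCommGroup HB] [NormedSpace ℝ HB] [FiniteDimensional ℝ HB]
    {HF : Type*} [NormedAddCommGroup HF] [NormedSpace ℝ HF] [FiniteDimensional ℝ HF]
    {E : Type*} [TopologicalSpace E] [T2Space E] [ParacompactSpace E]
    [ChartedSpace HE E] [IsManifold 𝓘(ℝ, HE) ∞ E]
    {B : Type*} [TopologicalSpace B] [T2Space B] [ParacompactSpace B]
    [ChartedSpace HB B] [IsManifold 𝓘(ℝ, HB) ∞ B]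
    {F : Type*} [TopologicalSpace F] [T2Space F] [ParacompactSpace F]
    [ChartedSpace HF F] [IsManifold 𝓘(ℝ, HF) ∞ F]
    (π : E → B) (hπ : CouplingDirac.IsSmoothFiberBundle HE HB HF F π)
    (D : CouplingDirac.GeometricData HE HB π) :
    D.IsIntegrable ↔ CouplingDirac.IsCourantClosed D.couplingBundle := by
  have hsurj := hπ.tangentMap_surjective
  rw [D.isCourantClosed_iff hπ.1,
    forall_congr' fun x ↦ (D.jet hπ.1 x).courantTensor_eq_zero_iff]
  simp only [forall_and]
  rw [← D.poisson_iff hπ.1, ← D.preserves_iff hπ.1 hsurj, ← D.curvature_eq_iff hπ.1 hsurj,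
    ← D.closed_iff hπ.1]
  exact ⟨fun h ↦ ⟨h.poisson, h.preserves, h.curvature_eq, h.closed⟩,
    fun h ↦ ⟨h.1, h.2.1, h.2.2.1, h.2.2.2⟩⟩
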